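/- Let $\ell>0$, $T>0$, $\delta_1>0$, and let $\varpi\subset\mathbb R^2$ be a bounded simply connected domain with smooth boundary that contains the origin. Let $v_1\in C^\infty(\mathbb R\times[0,\ell]\times[0,T])$, $v_1=v_1(s,x_1,t)$, be such that - for $t\in[0,T]\cap[0,\delta_1]$ it does not depend on $x_1\in[0,\ell]\cap[0,\delta_1]$; - for $x_1\in[0,\ell]\cap[\ell-\delta_1,\ell]$ and $t\in[0,T]$ it depends only on $t$, and there $v_1=\mathrm v_1(t)\ge\varsigma_0$ with a constant $\varsigma_0>0$; - for some constants $C_0,C_1$, $0\le v_1\le C_0$ and $|s\,\partial_sv_1|+|s\,\partial^2_{ss}v_1|\le C_1$ on $\mathbb R\times[0,\ell]\times[0,T]$. Let $\varphi=\varphi(s,x_1,\bar x_1,t)\in C^\infty(\mathbb R\times[0,\ell]\times\overline\varpi\times[0,T])$ be such that - $\varphi=0$ for $x_1\in[0,\ell]\cap[0,\delta_1]$, and $\varphi$ is independent of $s$ for $x_1\in[0,\ell]\cap[\ell-\delta_1,\ell]$; - for some constants $C_2,C_3,C_4$, $|\varphi|+|\partial_t\varphi|\le C_2|s|+C_3$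 and $|\partial_s\varphi|\le C_4$; - $\varphi|_{t=0}=0$. Put $$\widehat\varphi(s,x_1,t)=\frac1{|\varpi|}\int_{\partial\varpi}\varphi(s,x_1,\bar\xi,t)\,d\sigma_{\bar\xi},$$ where $|\varpi|$ is the area of $\varpi$ and $\sigma$ is arc length. Assume that $v_1(s,0,t)+s\,\partial_sv_1(s,0,t)>0$ for all $(s,t)\in\mathbb R\times[0,T]$, that $\widehat\varphi(s,x_1,t)\le0$ and $\partial_{x_1}v_1(s,x_1,t)\le0$ for all $s\ge0$, $x_1\in[0,\ell]$, $t\in[0,T]$, and that $$\partial_t\varphi|_{t=0}=\partial^2_{tt}\varphi|_{t=0}=0 .$$ Let $T_1\in(0,T]$ and let $w_0$ be a classical solution in $[0,\ell]\times[0,T_1]$ (that is, $w_0\in C^1([0,\ell]\times[0,T_1])$) of the limit problem $$\partial_tw_0+\partial_{x_1}\big(v_1(w_0,x_1,t)\,w_0\big)=-\widehat\varphi(w_0,x_1,t)\ \text{ in }(0,\ell)\times(0,T_1),$$ $$w_0(0,t)=0\ \ (t\in[0,T_1]),\qquad w_0(x_1,0)=0\ \ (x_1\in[0,\ell]).$$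 Then $w_0$ has continuous second derivatives in $[0,\ell]\times[0,T_1]$, that is, $w_0\in C^2([0,\ell]\times[0,T_1])$ (with one-sided derivatives at the boundary), and $\partial^2_{x_1x_1}w_0(x_1,0)=0$ and $\partial^2_{tt}w_0(x_1,0)=0$ for all $x_1\in[0,\ell]$. -/

import Mathlib

open Set MeasureTheory
open scoped ContDiff

noncomputable section

namespace ThinCylinder

/-- The plane containing the cross-section of the cylinder. -/
abbrev Plane : Type := EuclideanSpace ℝ (Fin 2)

/-- The boundary of `D` is smooth: near each of its points a `C^∞` diffeomorphism maps `D` onto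
the upper half-plane. -/
def HasSmoothBoundary (D : Set Plane) : Prop :=
  ∀ p ∈ frontier D, ∃ e : OpenPartialHomeomorph Plane Plane,
    p ∈ e.source ∧ ContDiffOn ℝ ∞ e e.source ∧ ContDiffOn ℝ ∞ e.symm e.target ∧
      e.IsImage D {y : Plane | 0 < y 1}

/-- Bounded simply connected plane domains with smooth boundary that contain the origin. -/
structure IsCrossSection (D : Set Plane) : Prop where
  isOpen : IsOpen D
  isBounded : Bornology.IsBounded D
  simplyConnected : IsSimplyConnected D
  smoothBoundary : HasSmoothBoundary D
  zero_mem : (0 : Plane) ∈ D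

/-- Assumptions on the longitudinal velocity `v₁(s, x₁, t)`. -/
structure VelocityAssumptions (ℓ T δ₁ : ℝ) (v₁ : ℝ → ℝ → ℝ → ℝ) : Prop where
  smooth : ContDiffOn ℝ ∞ (fun p : ℝ × ℝ × ℝ => v₁ p.1 p.2.1 p.2.2)
    (univ ×ˢ (Icc 0 ℓ ×ˢ Icc 0 T))
  indep_left : ∀ s : ℝ, ∀ t ∈ Icc 0 T, t ≤ δ₁ → ∀ x ∈ Icc 0 ℓ, x ≤ δ₁ → ∀ y ∈ Icc 0 ℓ, y ≤ δ₁ →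
    v₁ s x t = v₁ s y t
  right_end : ∃ ς : ℝ, 0 < ς ∧ ∃ V : ℝ → ℝ, ∀ t ∈ Icc 0 T, ς ≤ V t ∧
    ∀ s : ℝ, ∀ x ∈ Icc 0 ℓ, ℓ - δ₁ ≤ x → v₁ s x t = V t
  bounded : ∃ C₀ : ℝ, ∀ s : ℝ, ∀ x ∈ Icc 0 ℓ, ∀ t ∈ Icc 0 T, 0 ≤ v₁ s x t ∧ v₁ s x t ≤ C₀
  deriv_bounded : ∃ C₁ : ℝ, ∀ s : ℝ, ∀ x ∈ Icc 0 ℓ, ∀ t ∈ Icc 0 T,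
    |s * deriv (fun σ => v₁ σ x t) s| + |s * iteratedDeriv 2 (fun σ => v₁ σ x t) s| ≤ C₁

/-- Assumptions on the interaction function `φ(s, x₁, ξ, t)`, `ξ` in the closed cross-section. -/
structure InteractionAssumptions (ℓ T δ₁ : ℝ) (D : Set Plane) (φ : ℝ → ℝ → Plane → ℝ → ℝ) :
    Prop where
  smooth : ContDiffOn ℝ ∞ (fun p : ℝ × ℝ × Plane × ℝ => φ p.1 p.2.1 p.2.2.1 p.2.2.2)
    (univ ×ˢ (Icc 0 ℓ ×ˢ (closure D ×ˢ Icc 0 T)))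
  vanish_left : ∀ s : ℝ, ∀ x ∈ Icc 0 ℓ, x ≤ δ₁ → ∀ ξ ∈ closure D, ∀ t ∈ Icc 0 T, φ s x ξ t = 0
  indep_right : ∀ s s' : ℝ, ∀ x ∈ Icc 0 ℓ, ℓ - δ₁ ≤ x → ∀ ξ ∈ closure D, ∀ t ∈ Icc 0 T,
    φ s x ξ t = φ s' x ξ t
  growth : ∃ C₂ C₃ : ℝ, ∀ s : ℝ, ∀ x ∈ Icc 0 ℓ, ∀ ξ ∈ closure D, ∀ t ∈ Icc 0 T,
    |φ s x ξ t| + |derivWithin (fun τ => φ s x ξ τ) (Icc 0 T) t| ≤ C₂ * |s| + C₃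
  deriv_bounded : ∃ C₄ : ℝ, ∀ s : ℝ, ∀ x ∈ Icc 0 ℓ, ∀ ξ ∈ closure D, ∀ t ∈ Icc 0 T,
    |deriv (fun σ => φ σ x ξ t) s| ≤ C₄

/-- The averaged interaction function: the integral of `φ` over the boundary of the cross-section
with respect to arc length (one-dimensional Hausdorff measure), divided by the area of the
cross-section. -/
def phiHat (D : Set Plane) (φ : ℝ → ℝ → Plane → ℝ → ℝ) (s x t : ℝ) : ℝ :=
  (volume.real D)⁻¹ * ∫ ξ in frontier D, φ s x ξ t ∂(Measure.hausdorffMeasure 1)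

/-- `w` is a classical solution in `[0, ℓ] × [0, T₁]` of the limit problem
`∂ₜ w + ∂ₓ (v₁(w, x, t) w) = -φ̂(w, x, t)`, `w(0, t) = 0`, `w(x, 0) = 0`. -/
structure IsClassicalSolution (ℓ T₁ : ℝ) (D : Set Plane) (v₁ : ℝ → ℝ → ℝ → ℝ)
    (φ : ℝ → ℝ → Plane → ℝ → ℝ) (w : ℝ → ℝ → ℝ) : Prop where
  contDiffOn : ContDiffOn ℝ 1 (fun p : ℝ × ℝ => w p.1 p.2) (Icc 0 ℓ ×ˢ Icc 0 T₁)
  equation : ∀ x ∈ Ioo 0 ℓ, ∀ t ∈ Ioo 0 T₁,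
    deriv (fun τ => w x τ) t + deriv (fun y => v₁ (w y t) y t * w y t) x
      = -phiHat D φ (w x t) x t
  boundary : ∀ t ∈ Icc 0 T₁, w 0 t = 0
  initial : ∀ x ∈ Icc 0 ℓ, w x 0 = 0

end ThinCylinder

end

/-!
In quasilinear form the limit problem reads `∂ₜ w + Λ(w, x, t) ∂ₓ w = F(w, x, t)` with `w = 0` for
`x = 0` and for `t = 0`, where `Λ = ∂ₛ (s v₁)` (`charSpeed`) and `F = -φ̂ - s ∂ₓ v₁` (`sourceTerm`).
A `C¹` solution gains one derivative by the method of characteristics.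

*No corner singularity.* For `x ≤ δ₁` the function `φ̂` vanishes, so that `F` is proportional to
`s`, and `Λ > 0` at `x = 0`. A maximum principle (`eq_zero_of_homogeneous_strip`) shows that `w = 0`
in a strip along `x = 0`. In that strip `Λ` may be replaced by anything, in particular by a
coefficient that is negative at `x = 0` (`contDiffOn_two_of_inflow`). Since `Λ > 0` at `x = ℓ`, every
characteristic traced backwards now stays in `[0, ℓ]` down to `t = 0`, where the data vanish.

*Gain of one derivative.* Let `a(x, t) = Λ(w(x, t), x, t)` and let `Y₁`, `Y₂` be two characteristics
of `a`. If `u` has derivative `h` along characteristics, and the increments of `h` in `x` are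
`A₀ (x - y) + A₁ (u(x, t) - u(y, t))`, then `u(Y₁) - u(Y₂)` and `Y₁ - Y₂` satisfy linear equations,
and Duhamel's formula gives `u(Y₁) - u(Y₂) = J (Y₁ - Y₂)` with a factor `J` that depends continuously
on the characteristics, also when they coincide. So `u` is continuously differentiable in `x`, and
its derivative is again the solution of an equation along characteristics
(`IsTransported.exists_hasDivDiff`). Only continuity of the flow of `a` is used. The result is
applied to `u = w` and then to `u = ∂ₓ w`, for which `h` is a quadratic polynomial in `∂ₓ w` with
`C¹` coefficients (`contDiffOn_two_of_transport`).

*Smoothness of `φ̂`.* The boundary of the cross-section is compact and locally a Lipschitz image of a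
segment, hence of finite length, and one may differentiate under the integral sign
(`contDiffOn_phiHat`).

*Initial values.* `∂ₓₓ w(x, 0) = 0` is trivial, and `∂ₜₜ w(x, 0) = 0` follows by differentiating the
equation in `t` (`iteratedDerivWithin_two_time_eq_zero`).
-/

namespace ThinCylinder

open Filter Topology Measure intervalIntegral

/-! ### Arc length of the boundary of the cross-section -/

lemma IsCrossSection.isCompact_frontier {D : Set Plane} (hD : IsCrossSection D) :
    IsCompact (frontier D) :=
  Metric.isCompact_of_isClosed_isBounded isClosed_frontier
    (hD.isBounded.closure.subset frontier_subset_closure)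

lemma hausdorffMeasure_one_segment_lt_top (q : Plane) (r : ℝ) :
    μH[1] ({y : Plane | y 1 = 0} ∩ Metric.ball q r) < ⊤ := by
  set v : Plane := EuclideanSpace.single 0 1 with hv
  have hsub : {y : Plane | y 1 = 0} ∩ Metric.ball q r ⊆
      (ContinuousLinearMap.toSpanSingleton ℝ v) '' (Icc (q 0 - r) (q 0 + r)) := by
    rintro y ⟨hy1, hy⟩
    have hy0 : |y 0 - q 0| ≤ r := by
      have h1 : ‖(y - q) 0‖ ≤ ‖y - q‖ := PiLp.norm_apply_le (y - q) 0
      rw [Metric.mem_ball, dist_eq_norm] at hy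
      simpa using h1.trans hy.le
    refine ⟨y 0, ⟨by linarith [(abs_le.1 hy0).1], by linarith [(abs_le.1 hy0).2]⟩, ?_⟩
    ext i
    fin_cases i
    · simp [hv]
    · simpa [hv] using (hy1 : y 1 = 0).symm
  refine (measure_mono hsub).trans_lt ?_
  refine ((ContinuousLinearMap.toSpanSingleton ℝ v).lipschitz.hausdorffMeasure_image_le
    zero_le_one _).trans_lt ?_
  rw [hausdorffMeasure_real]
  simpa using ENNReal.mul_lt_top (by simp) (by simp)

/-- The boundary of a cross-section has finite length: it is compact, and near each of its points
the boundary chart exhibits it as the Lipschitz image of a segment. -/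
lemma IsCrossSection.hausdorffMeasure_frontier_lt_top {D : Set Plane} (hD : IsCrossSection D) :
    μH[1] (frontier D) < ⊤ := by
  refine hD.isCompact_frontier.measure_lt_top_of_nhdsWithin fun p hp => ?_
  obtain ⟨e, hpe, -, hsymm, himage⟩ := hD.smoothBoundary p hp
  have hq : e.target ∈ 𝓝 (e p) := e.open_target.mem_nhds (e.map_source hpe)
  obtain ⟨K, t, ht, hK⟩ :=
    ((hsymm.contDiffAt hq).of_le (by simp : (1 : WithTop ℕ∞) ≤ ∞)).exists_lipschitzOnWith
  obtain ⟨r, hr, hball⟩ := Metric.mem_nhds_iff.1 (inter_mem ht hq)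
  have hU : e.source ∩ e ⁻¹' Metric.ball (e p) r ∈ 𝓝 p :=
    inter_mem (e.open_source.mem_nhds hpe)
      ((e.continuousAt hpe).preimage_mem_nhds (Metric.ball_mem_nhds _ hr))
  refine ⟨frontier D ∩ (e.source ∩ e ⁻¹' Metric.ball (e p) r),
    inter_mem self_mem_nhdsWithin (mem_nhdsWithin_of_mem_nhds hU), ?_⟩
  have hsub : frontier D ∩ (e.source ∩ e ⁻¹' Metric.ball (e p) r) ⊆
      e.symm '' ({y : Plane | y 1 = 0} ∩ Metric.ball (e p) r) := by
    rintro x ⟨hxD, hxe, hxb⟩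
    refine ⟨e x, ⟨?_, hxb⟩, e.left_inv hxe⟩
    have h1 := frontier_lt_subset_eq continuous_const (by fun_prop)
      ((himage.frontier.apply_mem_iff hxe).2 hxD)
    exact h1.symm
  refine (measure_mono hsub).trans_lt ?_
  refine ((hK.mono ?_).hausdorffMeasure_image_le zero_le_one).trans_lt ?_
  · exact fun y hy => (hball hy.2).1
  · exact ENNReal.mul_lt_top (by simp) (hausdorffMeasure_one_segment_lt_top _ _)

/-! ### Integrals over a compact set depending on a parameter -/

section Parametric

variable {E P G : Type} [NormedAddCommGroup E] [NormedAddCommGroup P] [NormedAddCommGroup G]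
  {S : Set E} {K : Set P}

lemma continuousOn_section {Φ : E → P → G} (h : ContinuousOn (Function.uncurry Φ) (S ×ˢ K)) {p : E}
    (hp : p ∈ S) : ContinuousOn (Φ p) K :=
  h.comp (f := fun ξ => (p, ξ)) (by fun_prop) fun _ hξ => ⟨hp, hξ⟩

lemma eventually_forall_norm_sub_le (hK : IsCompact K) {Φ : E → P → G}
    (h : ContinuousOn (Function.uncurry Φ) (S ×ˢ K)) {p : E} (hp : p ∈ S) {ε : ℝ} (hε : 0 < ε) :
    ∀ᶠ q in 𝓝[S] p, ∀ ξ ∈ K, ‖Φ q ξ - Φ p ξ‖ ≤ ε := by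
  obtain ⟨v, hv, hvε⟩ := hK.mem_uniformity_of_prod h hp (Metric.dist_mem_uniformity hε)
  filter_upwards [hv] with q hq ξ hξ
  rw [← dist_eq_norm]
  exact le_of_lt (hvε q hq ξ hξ)

section Derivative

variable [NormedSpace ℝ E] [NormedSpace ℝ P] [NormedSpace ℝ G]

lemma contDiffOn_fderivWithin_section {m n : WithTop ℕ∞} (hS : UniqueDiffOn ℝ S) {Φ : E → P → G}
    (h : ContDiffOn ℝ n (Function.uncurry Φ) (S ×ˢ K)) (hmn : m + 1 ≤ n) :
    ContDiffOn ℝ m (fun z : E × P => fderivWithin ℝ (fun q => Φ q z.2) S z.1) (S ×ˢ K) := by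
  rintro ⟨p, ξ⟩ hz
  refine ContDiffWithinAt.fderivWithin'' (f := fun (z : E × P) q => Φ q z.2) (g := Prod.fst)
    (n := n) ?_ contDiffWithinAt_fst ?_ hmn ?_
  · rw [insert_eq_of_mem hz]
    exact (h (p, ξ) hz).comp (f := fun y : (E × P) × E => (y.2, y.1.2)) ((p, ξ), p)
      (by fun_prop) fun y hy => ⟨hy.2, hy.1.2⟩
  · rw [insert_eq_of_mem hz]
    filter_upwards [self_mem_nhdsWithin] with y hy using hS _ hy.1
  · refine mem_of_superset self_mem_nhdsWithin ?_
    rintro _ ⟨y, hy, rfl⟩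
    exact hy.1

lemma hasFDerivWithinAt_section {n : WithTop ℕ∞} {Φ : E → P → G}
    (h : ContDiffOn ℝ n (Function.uncurry Φ) (S ×ˢ K)) (hn : n ≠ 0) {p : E} (hp : p ∈ S) {ξ : P}
    (hξ : ξ ∈ K) :
    HasFDerivWithinAt (fun q => Φ q ξ) (fderivWithin ℝ (fun q => Φ q ξ) S p) S p :=
  DifferentiableWithinAt.hasFDerivWithinAt
    (((h.differentiableOn hn) (p, ξ) ⟨hp, hξ⟩).comp (f := fun q => (q, ξ)) p (by fun_prop)
      fun _ hq => ⟨hq, hξ⟩)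

end Derivative

variable [MeasurableSpace P] [BorelSpace P] [SecondCountableTopology P] {μ : Measure P}

lemma integrableOn_of_continuousOn_isCompact (hK : IsCompact K) (hμ : μ K < ⊤) {f : P → G}
    (hf : ContinuousOn f K) : IntegrableOn f K μ := by
  obtain ⟨C, hC⟩ := hK.exists_bound_of_continuousOn hf
  exact IntegrableOn.of_bound hμ (hf.aestronglyMeasurable hK.measurableSet) C
    ((ae_restrict_iff' hK.measurableSet).2 (Eventually.of_forall hC))

variable [NormedSpace ℝ G]

lemma norm_setIntegral_sub_le (hK : IsCompact K) (hμ : μ K < ⊤) {f g : P → G}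
    (hf : ContinuousOn f K) (hg : ContinuousOn g K) {C : ℝ} (h : ∀ ξ ∈ K, ‖f ξ - g ξ‖ ≤ C) :
    ‖(∫ ξ in K, f ξ ∂μ) - ∫ ξ in K, g ξ ∂μ‖ ≤ C * μ.real K := by
  rw [← integral_sub (integrableOn_of_continuousOn_isCompact hK hμ hf)
    (integrableOn_of_continuousOn_isCompact hK hμ hg)]
  exact norm_setIntegral_le_of_norm_le_const hμ h

lemma continuousOn_setIntegral (hK : IsCompact K) (hμ : μ K < ⊤) {Φ : E → P → G}
    (h : ContinuousOn (Function.uncurry Φ) (S ×ˢ K)) :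
    ContinuousOn (fun p => ∫ ξ in K, Φ p ξ ∂μ) S := by
  intro p hp
  refine Metric.tendsto_nhds.2 fun ε hε => ?_
  have hm : 0 < μ.real K + 1 := by positivity
  filter_upwards [eventually_forall_norm_sub_le hK h hp (div_pos hε hm), self_mem_nhdsWithin]
    with q hq hqS
  rw [dist_eq_norm]
  refine (norm_setIntegral_sub_le hK hμ (continuousOn_section h hqS)
    (continuousOn_section h hp) hq).trans_lt ?_
  rw [div_mul_eq_mul_div, div_lt_iff₀ hm]
  nlinarith

variable [NormedSpace ℝ E]

/-- Differentiation under the integral sign relative to a convex set of parameters, which need not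
be a neighbourhood of the point in question. -/
lemma hasFDerivWithinAt_setIntegral [CompleteSpace G] (hS : Convex ℝ S) (hK : IsCompact K)
    (hμ : μ K < ⊤) {Φ : E → P → G} {Φ' : E → P → E →L[ℝ] G}
    (h : ContinuousOn (Function.uncurry Φ) (S ×ˢ K))
    (h' : ContinuousOn (Function.uncurry Φ') (S ×ˢ K))
    (hd : ∀ p ∈ S, ∀ ξ ∈ K, HasFDerivWithinAt (fun q => Φ q ξ) (Φ' p ξ) S p) {p : E}
    (hp : p ∈ S) :
    HasFDerivWithinAt (fun q => ∫ ξ in K, Φ q ξ ∂μ) (∫ ξ in K, Φ' p ξ ∂μ) S p := by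
  rw [hasFDerivWithinAt_iff_isLittleO, Asymptotics.isLittleO_iff]
  intro c hc
  have hm : 0 < μ.real K + 1 := by positivity
  have hev := eventually_forall_norm_sub_le hK h' hp (div_pos hc hm)
  obtain ⟨r, hr, hball⟩ := Metric.mem_nhdsWithin_iff.1 hev
  filter_upwards [self_mem_nhdsWithin, mem_nhdsWithin_of_mem_nhds (Metric.ball_mem_nhds p hr)]
    with q hqS hqr
  have hint' := integrableOn_of_continuousOn_isCompact hK hμ (continuousOn_section h' hp)
  have hcont : ContinuousOn (fun ξ => Φ q ξ - Φ p ξ) K :=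
    (continuousOn_section h hqS).sub (continuousOn_section h hp)
  have hcont' : ContinuousOn (fun ξ => Φ' p ξ (q - p)) K :=
    (continuousOn_section h' hp).clm_apply continuousOn_const
  rw [← integral_sub (integrableOn_of_continuousOn_isCompact hK hμ (continuousOn_section h hqS))
    (integrableOn_of_continuousOn_isCompact hK hμ (continuousOn_section h hp)),
    ContinuousLinearMap.integral_apply hint']
  refine (norm_setIntegral_sub_le hK hμ hcont hcont' (C := c / (μ.real K + 1) * ‖q - p‖)
    fun ξ hξ => ?_).trans ?_
  · have hconv : Convex ℝ (S ∩ Metric.ball p r) := hS.inter (convex_ball p r)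
    exact hconv.norm_image_sub_le_of_norm_hasFDerivWithin_le'
      (fun x hx => (hd x hx.1 ξ hξ).mono inter_subset_left)
      (fun x hx => hball ⟨hx.2, hx.1⟩ ξ hξ) ⟨hp, Metric.mem_ball_self hr⟩ ⟨hqS, hqr⟩
  · have : c / (μ.real K + 1) * ‖q - p‖ * μ.real K
        = c * ‖q - p‖ * (μ.real K / (μ.real K + 1)) := by ring
    rw [this]
    exact mul_le_of_le_one_right (by positivity) ((div_le_one hm).2 (by linarith))

variable [NormedSpace ℝ P]

/-- The derivative of a parametric integral, as the integral of the derivative. -/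
lemma hasFDerivWithinAt_setIntegral_of_contDiffOn [CompleteSpace G] (hS : Convex ℝ S)
    (hSu : UniqueDiffOn ℝ S) (hK : IsCompact K) (hμ : μ K < ⊤) {n : WithTop ℕ∞} (hn : 1 ≤ n)
    {Φ : E → P → G} (h : ContDiffOn ℝ n (Function.uncurry Φ) (S ×ˢ K)) {p : E} (hp : p ∈ S) :
    HasFDerivWithinAt (fun q => ∫ ξ in K, Φ q ξ ∂μ)
      (∫ ξ in K, fderivWithin ℝ (fun q => Φ q ξ) S p ∂μ) S p :=
  hasFDerivWithinAt_setIntegral (Φ' := fun p ξ => fderivWithin ℝ (fun q => Φ q ξ) S p)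
    hS hK hμ h.continuousOn
    (contDiffOn_fderivWithin_section (m := 0) hSu h (by simpa using hn)).continuousOn
    (fun _ hp _ hξ => hasFDerivWithinAt_section h (by rintro rfl; simp at hn) hp hξ) hp

lemma contDiffOn_setIntegral (hS : Convex ℝ S) (hSu : UniqueDiffOn ℝ S) (hK : IsCompact K)
    (hμ : μ K < ⊤) (n : ℕ) :
    ∀ {G : Type} [NormedAddCommGroup G] [NormedSpace ℝ G] [CompleteSpace G] {Φ : E → P → G},
      ContDiffOn ℝ n (Function.uncurry Φ) (S ×ˢ K) →
      ContDiffOn ℝ n (fun p => ∫ ξ in K, Φ p ξ ∂μ) S := by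
  induction n with
  | zero =>
    intro G _ _ _ Φ h
    exact contDiffOn_zero.2 (continuousOn_setIntegral hK hμ h.continuousOn)
  | succ n ih =>
    intro G _ _ _ Φ h
    have hd : ∀ p ∈ S, _ := fun p hp =>
      hasFDerivWithinAt_setIntegral_of_contDiffOn (μ := μ) hS hSu hK hμ (by simp) h hp
    push_cast
    refine (contDiffOn_succ_iff_fderivWithin hSu).2
      ⟨fun p hp => (hd p hp).differentiableWithinAt, by simp, ?_⟩
    refine ContDiffOn.congr (ih (Φ := fun p ξ => fderivWithin ℝ (fun q => Φ q ξ) S p) ?_)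
      fun p hp => (hd p hp).fderivWithin (hSu p hp)
    exact contDiffOn_fderivWithin_section hSu h (by simp)

end Parametric

/-! ### Clamping to an interval -/

/-- The nearest point of `[0, c]` to `x`. -/
def clamp (c x : ℝ) : ℝ := max 0 (min c x)

lemma clamp_mem {c : ℝ} (hc : 0 ≤ c) (x : ℝ) : clamp c x ∈ Icc 0 c :=
  ⟨le_max_left _ _, max_le hc (min_le_left _ _)⟩

lemma clamp_of_mem {c x : ℝ} (hx : x ∈ Icc 0 c) : clamp c x = x := by
  rw [clamp, min_eq_right hx.2, max_eq_right hx.1]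

@[fun_prop]
lemma continuous_clamp (c : ℝ) : Continuous (clamp c) := by
  unfold clamp; fun_prop

lemma abs_clamp_sub_le (c x y : ℝ) : |clamp c x - clamp c y| ≤ |x - y| := by
  refine (abs_max_sub_max_le_max _ _ _ _).trans (max_le (by simp) ?_)
  exact (abs_min_sub_min_le_max _ _ _ _).trans (by simp)

/-- The nearest point of the rectangle `[0, ℓ] × [0, T]`. -/
def clampBox (ℓ T : ℝ) (p : ℝ × ℝ) : ℝ × ℝ := (clamp ℓ p.1, clamp T p.2)

lemma clampBox_mem {ℓ T : ℝ} (hℓ : 0 ≤ ℓ) (hT : 0 ≤ T) (p : ℝ × ℝ) :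
    clampBox ℓ T p ∈ Icc 0 ℓ ×ˢ Icc 0 T :=
  ⟨clamp_mem hℓ _, clamp_mem hT _⟩

lemma clampBox_of_mem {ℓ T : ℝ} {p : ℝ × ℝ} (hp : p ∈ Icc 0 ℓ ×ˢ Icc 0 T) :
    clampBox ℓ T p = p :=
  Prod.ext (clamp_of_mem hp.1) (clamp_of_mem hp.2)

@[fun_prop]
lemma continuous_clampBox (ℓ T : ℝ) : Continuous (clampBox ℓ T) := by
  unfold clampBox; fun_prop

lemma continuous_comp_clampBox {ℓ T : ℝ} (hℓ : 0 ≤ ℓ) (hT : 0 ≤ T) {g : ℝ × ℝ → ℝ}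
    (hg : ContinuousOn g (Icc 0 ℓ ×ˢ Icc 0 T)) : Continuous fun p => g (clampBox ℓ T p) :=
  hg.comp_continuous (continuous_clampBox ℓ T) (clampBox_mem hℓ hT)

lemma uniqueDiffOn_box {ℓ T : ℝ} (hℓ : 0 < ℓ) (hT : 0 < T) :
    UniqueDiffOn ℝ (Icc 0 ℓ ×ˢ Icc 0 T) :=
  (uniqueDiffOn_Icc hℓ).prod (uniqueDiffOn_Icc hT)

/-! ### Divided differences in the space variable -/

/-- `γ` is a continuous divided difference of `g` in the space variable `x`. This form of
continuous differentiability in `x`, with derivative `γ (x, x, t)`, is stable under integration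
along pairs of characteristics. -/
structure HasDivDiff (ℓ T : ℝ) (g : ℝ × ℝ → ℝ) (γ : ℝ × ℝ × ℝ → ℝ) : Prop where
  continuous : Continuous γ
  sub_eq : ∀ x ∈ Icc 0 ℓ, ∀ y ∈ Icc 0 ℓ, ∀ t ∈ Icc 0 T,
    g (x, t) - g (y, t) = γ (x, y, t) * (x - y)

lemma hasDerivWithinAt_fst_of_hasFDerivWithinAt {ℓ T : ℝ} {g : ℝ × ℝ → ℝ} {g' : ℝ × ℝ →L[ℝ] ℝ}
    {x t : ℝ} (ht : t ∈ Icc 0 T)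
    (h : HasFDerivWithinAt g g' (Icc 0 ℓ ×ˢ Icc 0 T) (x, t)) :
    HasDerivWithinAt (fun y => g (y, t)) (g' (1, 0)) (Icc 0 ℓ) x :=
  h.comp_hasDerivWithinAt (f := fun y => (y, t)) x
    ((hasDerivWithinAt_id x _).prodMk (hasDerivWithinAt_const x _ t)) fun _ hy => ⟨hy, ht⟩

lemma hasDerivWithinAt_snd_of_hasFDerivWithinAt {ℓ T : ℝ} {g : ℝ × ℝ → ℝ} {g' : ℝ × ℝ →L[ℝ] ℝ}
    {x t : ℝ} (hx : x ∈ Icc 0 ℓ)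
    (h : HasFDerivWithinAt g g' (Icc 0 ℓ ×ˢ Icc 0 T) (x, t)) :
    HasDerivWithinAt (fun τ => g (x, τ)) (g' (0, 1)) (Icc 0 T) t :=
  h.comp_hasDerivWithinAt (f := fun τ => (x, τ)) t
    ((hasDerivWithinAt_const t _ x).prodMk (hasDerivWithinAt_id t _)) fun _ hy => ⟨hx, hy⟩

/-- A `C¹` function on the rectangle has a continuous divided difference: the mean of its
derivative over the segment between the two points. -/
lemma exists_hasDivDiff {ℓ T : ℝ} (hℓ : 0 < ℓ) (hT : 0 < T) {g : ℝ × ℝ → ℝ}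
    (hg : ContDiffOn ℝ 1 g (Icc 0 ℓ ×ˢ Icc 0 T)) :
    ∃ γ, HasDivDiff ℓ T g γ ∧ ∀ x ∈ Icc 0 ℓ, ∀ t ∈ Icc 0 T,
      γ (x, x, t) = fderivWithin ℝ g (Icc 0 ℓ ×ˢ Icc 0 T) (x, t) (1, 0) := by
  set g' : ℝ × ℝ → ℝ := fun p => fderivWithin ℝ g (Icc 0 ℓ ×ˢ Icc 0 T) p (1, 0) with hg'
  have hcont : ContinuousOn g' (Icc 0 ℓ ×ˢ Icc 0 T) :=
    (hg.continuousOn_fderivWithin (uniqueDiffOn_box hℓ hT) le_rfl).clm_apply continuousOn_const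
  have hGc := continuous_comp_clampBox hℓ.le hT.le hcont
  set G : ℝ × ℝ → ℝ := fun p => g' (clampBox ℓ T p) with hG
  have hGeq : ∀ x ∈ Icc 0 ℓ, ∀ t ∈ Icc 0 T, G (x, t) = g' (x, t) := fun x hx t ht => by
    simp only [hG]; rw [clampBox_of_mem ⟨hx, ht⟩]
  have hd : ∀ x ∈ Icc 0 ℓ, ∀ t ∈ Icc 0 T,
      HasDerivWithinAt (fun y => g (y, t)) (G (x, t)) (Icc 0 ℓ) x := fun x hx t ht => by
    rw [hGeq x hx t ht]
    exact hasDerivWithinAt_fst_of_hasFDerivWithinAt ht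
      (hg.differentiableOn one_ne_zero (x, t) ⟨hx, ht⟩).hasFDerivWithinAt
  refine ⟨fun p => ∫ θ in (0 : ℝ)..1, G (p.2.1 + θ * (p.1 - p.2.1), p.2.2), ⟨?_, ?_⟩, ?_⟩
  · exact continuous_parametric_intervalIntegral_of_continuous' (by fun_prop) 0 1
  · intro x hx y hy t ht
    have hmem : ∀ θ ∈ Icc (0 : ℝ) 1, y + θ * (x - y) ∈ Icc 0 ℓ := fun θ hθ =>
      (convex_Icc 0 ℓ).add_smul_sub_mem hy hx hθ
    have hderiv : ∀ θ ∈ Icc (0 : ℝ) 1, HasDerivWithinAt (fun θ => g (y + θ * (x - y), t))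
        (G (y + θ * (x - y), t) * (x - y)) (Icc 0 1) θ := fun θ hθ => by
      refine (hd _ (hmem θ hθ) t ht).comp θ (h := fun θ => y + θ * (x - y)) ?_ hmem
      simpa using (((hasDerivAt_id θ).mul_const (x - y)).const_add y).hasDerivWithinAt
    have := integral_eq_sub_of_hasDerivAt_of_le (zero_le_one' ℝ)
      (fun θ hθ => (hderiv θ hθ).continuousWithinAt)
      (fun θ hθ => (hderiv θ (Ioo_subset_Icc_self hθ)).hasDerivAt (Icc_mem_nhds hθ.1 hθ.2))
      (Continuous.intervalIntegrable (by fun_prop) 0 1)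
    simp only [one_mul, zero_mul, add_zero, add_sub_cancel] at this
    rw [← this, intervalIntegral.integral_mul_const]
  · intro x hx t ht
    simp only [sub_self, mul_zero, add_zero, hGeq x hx t ht, intervalIntegral.integral_const,
      sub_zero, one_smul, hg']

/-! ### Characteristics -/

/-- A scalar Grönwall estimate in both time directions. -/
lemma abs_sub_le_of_abs_deriv_sub_le {T K : ℝ} {f g f' g' : ℝ → ℝ}
    (hf : ∀ t ∈ Icc 0 T, HasDerivWithinAt f (f' t) (Icc 0 T) t)
    (hg : ∀ t ∈ Icc 0 T, HasDerivWithinAt g (g' t) (Icc 0 T) t)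
    (hK : ∀ t ∈ Icc 0 T, |f' t - g' t| ≤ K * |f t - g t|) {s t : ℝ} (hs : s ∈ Icc 0 T)
    (ht : t ∈ Icc 0 T) :
    |f t - g t| ≤ Real.exp (K * |t - s|) * |f s - g s| := by
  have key : ∀ c : ℝ, ∀ t ∈ Icc 0 T,
      HasDerivWithinAt (fun t => (f t - g t) ^ 2 * Real.exp (2 * c * t))
        ((2 * ((f t - g t) * (f' t - g' t)) + 2 * c * (f t - g t) ^ 2) * Real.exp (2 * c * t))
        (Icc 0 T) t := by
    intro c t ht
    have h1 := ((hf t ht).sub (hg t ht)).pow 2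
    have h2 : HasDerivWithinAt (fun t => Real.exp (2 * c * t))
        (Real.exp (2 * c * t) * (2 * c)) (Icc 0 T) t := by
      simpa using (((hasDerivAt_id t).const_mul (2 * c)).exp).hasDerivWithinAt
    convert! h1.mul h2 using 1
    simp only [Pi.sub_apply, Nat.cast_ofNat, Pi.pow_apply]
    ring
  have hprod : ∀ t ∈ Icc 0 T, |(f t - g t) * (f' t - g' t)| ≤ K * (f t - g t) ^ 2 := by
    intro t ht
    rw [abs_mul, ← sq_abs (f t - g t)]
    nlinarith [hK t ht, abs_nonneg (f t - g t)]
  have hconv : Convex ℝ (Icc 0 T) := convex_Icc 0 T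
  have hanti : AntitoneOn (fun t => (f t - g t) ^ 2 * Real.exp (2 * (-K) * t)) (Icc 0 T) := by
    refine antitoneOn_of_hasDerivWithinAt_nonpos hconv
      (fun t ht => (key (-K) t ht).continuousWithinAt)
      (fun t ht => (key (-K) t (interior_subset ht)).mono interior_subset) fun t ht => ?_
    refine mul_nonpos_of_nonpos_of_nonneg ?_ (Real.exp_pos _).le
    linarith [(abs_le.1 (hprod t (interior_subset ht))).2]
  have hmono : MonotoneOn (fun t => (f t - g t) ^ 2 * Real.exp (2 * K * t)) (Icc 0 T) := by
    refine monotoneOn_of_hasDerivWithinAt_nonneg hconv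
      (fun t ht => (key K t ht).continuousWithinAt)
      (fun t ht => (key K t (interior_subset ht)).mono interior_subset) fun t ht => ?_
    refine mul_nonneg ?_ (Real.exp_pos _).le
    linarith [(abs_le.1 (hprod t (interior_subset ht))).1]
  refine abs_le_of_sq_le_sq ?_ (by positivity)
  rw [mul_pow, sq_abs, ← Real.exp_nat_mul]
  rcases le_total s t with h | h
  · have h1 := hanti hs ht h
    rw [abs_of_nonneg (sub_nonneg.2 h)]
    have h2 := mul_le_mul_of_nonneg_right h1 (Real.exp_pos (2 * K * t)).le
    simp only [mul_assoc, ← Real.exp_add] at h2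
    calc (f t - g t) ^ 2 = (f t - g t) ^ 2 * Real.exp (2 * (-K * t) + 2 * (K * t)) := by
          rw [show 2 * (-K * t) + 2 * (K * t) = 0 by ring, Real.exp_zero, mul_one]
      _ ≤ _ := h2
      _ = _ := by rw [mul_comm]; congr 2; push_cast; ring
  · have h1 := hmono ht hs h
    rw [abs_of_nonpos (sub_nonpos.2 h)]
    have h2 := mul_le_mul_of_nonneg_right h1 (Real.exp_pos (2 * (-K) * t)).le
    simp only [mul_assoc, ← Real.exp_add] at h2
    calc (f t - g t) ^ 2 = (f t - g t) ^ 2 * Real.exp (2 * (K * t) + 2 * (-K * t)) := by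
          rw [show 2 * (K * t) + 2 * (-K * t) = 0 by ring, Real.exp_zero, mul_one]
      _ ≤ _ := h2
      _ = _ := by rw [mul_comm]; congr 2; push_cast; ring

/-- `Y` is a characteristic of the field `a` on the time interval `[0, t]` that stays in
`[0, ℓ]`. -/
def IsCharacteristic (ℓ : ℝ) (a : ℝ × ℝ → ℝ) (t : ℝ) (Y : ℝ → ℝ) : Prop :=
  ∀ τ ∈ Icc 0 t, Y τ ∈ Icc 0 ℓ ∧ HasDerivWithinAt Y (a (Y τ, τ)) (Icc 0 t) τ

lemma IsCharacteristic.mono {ℓ : ℝ} {a : ℝ × ℝ → ℝ} {s t : ℝ} {Y : ℝ → ℝ}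
    (h : IsCharacteristic ℓ a t Y) (hst : s ≤ t) : IsCharacteristic ℓ a s Y := fun τ hτ =>
  have hsub : Icc 0 s ⊆ Icc 0 t := Icc_subset_Icc_right hst
  ⟨(h τ (hsub hτ)).1, (h τ (hsub hτ)).2.mono hsub⟩

lemma HasDivDiff.exists_lipschitz {ℓ T : ℝ} {a : ℝ × ℝ → ℝ} {α : ℝ × ℝ × ℝ → ℝ}
    (h : HasDivDiff ℓ T a α) : ∃ K : ℝ, 0 ≤ K ∧ ∀ x ∈ Icc 0 ℓ, ∀ y ∈ Icc 0 ℓ, ∀ t ∈ Icc 0 T,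
      |a (x, t) - a (y, t)| ≤ K * |x - y| := by
  have hcomp : IsCompact (Icc 0 ℓ ×ˢ (Icc 0 ℓ ×ˢ Icc 0 T)) :=
    isCompact_Icc.prod (isCompact_Icc.prod isCompact_Icc)
  obtain ⟨K, hK⟩ := hcomp.exists_bound_of_continuousOn h.continuous.continuousOn
  refine ⟨max K 0, le_max_right _ _, fun x hx y hy t ht => ?_⟩
  rw [h.sub_eq x hx y hy t ht, abs_mul]
  exact mul_le_mul_of_nonneg_right ((hK (x, y, t) ⟨hx, hy, ht⟩).trans (le_max_left _ _))
    (abs_nonneg _)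

lemma IsCharacteristic.eqOn {ℓ T : ℝ} {a : ℝ × ℝ → ℝ} {α : ℝ × ℝ × ℝ → ℝ}
    (h : HasDivDiff ℓ T a α) {t : ℝ} (ht : t ∈ Icc 0 T) {Y Z : ℝ → ℝ}
    (hY : IsCharacteristic ℓ a t Y) (hZ : IsCharacteristic ℓ a t Z) (heq : Y t = Z t) :
    EqOn Y Z (Icc 0 t) := by
  obtain ⟨K, -, hK⟩ := h.exists_lipschitz
  intro τ hτ
  have := abs_sub_le_of_abs_deriv_sub_le (fun τ hτ => (hY τ hτ).2) (fun τ hτ => (hZ τ hτ).2)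
    (fun τ hτ => hK _ (hY τ hτ).1 _ (hZ τ hτ).1 τ ⟨hτ.1, hτ.2.trans ht.2⟩)
    (right_mem_Icc.2 ht.1) hτ
  rw [heq, sub_self, abs_zero, mul_zero] at this
  exact sub_eq_zero.1 (abs_eq_zero.1 (le_antisymm this (abs_nonneg _)))

/-- A solution that is in `[0, ℓ]` at time `t` was there at all earlier times, if the field points
out of `[0, ℓ]` at both ends. -/
lemma mem_Icc_of_outward {ℓ t : ℝ} {b : ℝ → ℝ → ℝ} {Y : ℝ → ℝ}
    (hY : ∀ τ ∈ Icc 0 t, HasDerivWithinAt Y (b (Y τ) τ) (Icc 0 t) τ)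
    (h0 : ∀ τ ∈ Icc 0 t, b 0 τ < 0) (h1 : ∀ τ ∈ Icc 0 t, 0 < b ℓ τ) (hYt : Y t ∈ Icc 0 ℓ) :
    ∀ τ ∈ Icc 0 t, Y τ ∈ Icc 0 ℓ := by
  have hmaps : MapsTo (fun s => t - s) (Icc 0 t) (Icc 0 t) := fun s hs =>
    ⟨by linarith [hs.2], by linarith [hs.1]⟩
  have hR : ∀ s ∈ Icc 0 t, HasDerivWithinAt (fun s => Y (t - s)) (-b (Y (t - s)) (t - s))
      (Icc 0 t) s := fun s hs => by
    have := (hY _ (hmaps hs)).comp s (h := fun s => t - s)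
      ((hasDerivAt_id s).const_sub t).hasDerivWithinAt hmaps
    rw [mul_neg_one] at this
    exact this
  have hRc : ContinuousOn (fun s => Y (t - s)) (Icc 0 t) := fun s hs =>
    (hR s hs).continuousWithinAt
  have hRr : ∀ s ∈ Ico 0 t, HasDerivWithinAt (fun s => Y (t - s)) (-b (Y (t - s)) (t - s))
      (Ici s) s := fun s hs =>
    (hR s (Ico_subset_Icc_self hs)).mono_of_mem_nhdsWithin (Icc_mem_nhdsGE_of_mem hs)
  intro τ hτ
  have hτ' := hmaps hτ
  have hupper := image_le_of_deriv_right_lt_deriv_boundary (B := fun _ => ℓ) (B' := fun _ => 0)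
    hRc hRr (by simpa using hYt.2) (fun _ => hasDerivAt_const _ _)
    (fun s hs heq => by
      have h' : Y (t - s) = ℓ := heq
      rw [h']
      linarith [h1 _ (hmaps (Ico_subset_Icc_self hs))]) hτ'
  have hlower := image_le_of_deriv_right_lt_deriv_boundary (f := fun s => -Y (t - s))
    (f' := fun s => - -b (Y (t - s)) (t - s)) (B := fun _ => 0) (B' := fun _ => 0)
    hRc.neg (fun s hs => (hRr s hs).neg) (by simpa using hYt.1) (fun _ => hasDerivAt_const _ _)
    (fun s hs heq => by
      have h' : Y (t - s) = 0 := by simpa using heq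
      rw [h']
      linarith [h0 _ (hmaps (Ico_subset_Icc_self hs))]) hτ'
  simp only [sub_sub_cancel] at hupper hlower
  exact ⟨by linarith, hupper⟩

/-- Global solutions of a scalar equation with bounded Lipschitz right-hand side, and their
continuous dependence on the time, the initial value and the initial time. -/
lemma exists_continuous_flow {T M K : ℝ} (hT : 0 ≤ T) {b : ℝ → ℝ → ℝ}
    (hK0 : 0 ≤ K) (hb : ∀ x, Continuous (b x)) (hM : ∀ x t, |b x t| ≤ M)
    (hK : ∀ x y t, |b x t - b y t| ≤ K * |x - y|) :
    ∃ Z : ℝ × ℝ × ℝ → ℝ, Continuous Z ∧ ∀ x, ∀ t ∈ Icc 0 T, Z (t, x, t) = x ∧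
      ∀ τ ∈ Icc 0 T, HasDerivWithinAt (fun σ => Z (σ, x, t)) (b (Z (τ, x, t)) τ) (Icc 0 T) τ := by
  have hM0 : 0 ≤ M := (abs_nonneg _).trans (hM 0 0)
  have hex : ∀ x t : ℝ, ∃ Y : ℝ → ℝ, Y (clamp T t) = x ∧
      ∀ τ ∈ Icc 0 T, HasDerivWithinAt Y (b (Y τ) τ) (Icc 0 T) τ := by
    intro x t
    have hpl : IsPicardLindelof (fun t x => b x t) (⟨clamp T t, clamp_mem hT t⟩ : Icc 0 T) x
        (M.toNNReal * T.toNNReal) 0 M.toNNReal K.toNNReal := by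
      refine ⟨fun τ _ => LipschitzOnWith.of_dist_le_mul fun y _ z _ => ?_,
        fun y _ => (hb y).continuousOn, fun τ _ y _ => ?_, ?_⟩
      · rw [Real.coe_toNNReal _ hK0]; exact hK y z τ
      · rw [Real.coe_toNNReal _ hM0]; exact hM y τ
      · push_cast
        rw [Real.coe_toNNReal _ hM0, Real.coe_toNNReal _ hT]
        simp only [sub_zero]
        have := clamp_mem hT t
        exact mul_le_mul_of_nonneg_left
          (max_le (by linarith [this.1]) (by linarith [this.2])) hM0
    exact hpl.exists_eq_forall_mem_Icc_hasDerivWithinAt₀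
  choose y hy0 hy using hex
  have htime : ∀ x t, ∀ τ ∈ Icc 0 T, ∀ σ ∈ Icc 0 T, |y x t τ - y x t σ| ≤ M * |τ - σ| :=
    fun x t τ hτ σ hσ => (convex_Icc 0 T).norm_image_sub_le_of_norm_hasDerivWithin_le
      (hy x t) (fun _ _ => hM _ _) hσ hτ
  have hest : ∀ x t x' t', ∀ τ ∈ Icc 0 T, ∀ τ' ∈ Icc 0 T, |y x t τ - y x' t' τ'| ≤
      Real.exp (K * T) * (|x - x'| + M * |t' - t|) + M * |τ - τ'| := by
    intro x t x' t' τ hτ τ' hτ'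
    have hc' := clamp_mem hT t'
    have h1 := abs_sub_le_of_abs_deriv_sub_le (hy x t) (hy x' t')
      (fun τ _ => hK (y x t τ) (y x' t' τ) τ) hc' hτ
    have h2 : |y x t (clamp T t') - y x' t' (clamp T t')| ≤ |x - x'| + M * |t' - t| := by
      rw [hy0 x' t']
      calc |y x t (clamp T t') - x'|
          = |(y x t (clamp T t') - y x t (clamp T t)) + (x - x')| := by
            rw [hy0 x t]; congr 1; ring
        _ ≤ |y x t (clamp T t') - y x t (clamp T t)| + |x - x'| := abs_add_le _ _
        _ ≤ M * |t' - t| + |x - x'| := by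
            gcongr
            exact (htime x t _ hc' _ (clamp_mem hT t)).trans
              (mul_le_mul_of_nonneg_left (abs_clamp_sub_le _ _ _) hM0)
        _ = _ := add_comm _ _
    have h3 : Real.exp (K * |τ - clamp T t'|) ≤ Real.exp (K * T) := by
      refine Real.exp_le_exp.2 (mul_le_mul_of_nonneg_left (abs_le.2 ⟨?_, ?_⟩) hK0)
      · linarith [hτ.1, hc'.2]
      · linarith [hτ.2, hc'.1]
    calc |y x t τ - y x' t' τ'|
        ≤ |y x t τ - y x' t' τ| + |y x' t' τ - y x' t' τ'| := abs_sub_le _ _ _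
      _ ≤ _ := add_le_add (h1.trans (mul_le_mul h3 h2 (abs_nonneg _) (Real.exp_pos _).le))
          (htime x' t' τ hτ τ' hτ')
  refine ⟨fun p => y p.2.1 p.2.2 (clamp T p.1), ?_, fun x t ht => ⟨?_, fun τ hτ => ?_⟩⟩
  · refine continuous_iff_continuousAt.2 fun p => tendsto_iff_dist_tendsto_zero.2 ?_
    have hlim : Tendsto (fun q : ℝ × ℝ × ℝ => Real.exp (K * T) *
        (|q.2.1 - p.2.1| + M * |p.2.2 - q.2.2|) + M * |clamp T q.1 - clamp T p.1|) (𝓝 p) (𝓝 0) := by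
      have : Continuous (fun q : ℝ × ℝ × ℝ => Real.exp (K * T) *
        (|q.2.1 - p.2.1| + M * |p.2.2 - q.2.2|) + M * |clamp T q.1 - clamp T p.1|) := by
        fun_prop
      simpa using this.tendsto p
    exact squeeze_zero (fun _ => dist_nonneg)
      (fun q => hest _ _ _ _ _ (clamp_mem hT _) _ (clamp_mem hT _)) hlim
  · have := hy0 x t
    rw [clamp_of_mem ht] at this
    simpa only [clamp_of_mem ht] using this
  · simp only [clamp_of_mem hτ]
    exact (hy x t τ hτ).congr (fun σ hσ => by rw [clamp_of_mem hσ]) (by rw [clamp_of_mem hτ])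

/-- The flow of a field that points out of `[0, ℓ]` at both ends: `Z (τ, x, t)` is the position at
time `τ` of the characteristic that is at `x` at time `t`. -/
lemma exists_characteristic_flow {ℓ T : ℝ} (hℓ : 0 ≤ ℓ) (hT : 0 ≤ T) {a : ℝ × ℝ → ℝ}
    {α : ℝ × ℝ × ℝ → ℝ} (ha : Continuous a) (hα : HasDivDiff ℓ T a α)
    (h0 : ∀ t ∈ Icc 0 T, a (0, t) < 0) (h1 : ∀ t ∈ Icc 0 T, 0 < a (ℓ, t)) :
    ∃ Z : ℝ × ℝ × ℝ → ℝ, Continuous Z ∧ ∀ x ∈ Icc 0 ℓ, ∀ t ∈ Icc 0 T, Z (t, x, t) = x ∧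
      IsCharacteristic ℓ a t (fun τ => Z (τ, x, t)) := by
  obtain ⟨K, hK0, hK⟩ := hα.exists_lipschitz
  obtain ⟨M, hM⟩ := (isCompact_Icc.prod isCompact_Icc :
    IsCompact (Icc 0 ℓ ×ˢ Icc 0 T)).exists_bound_of_continuousOn ha.continuousOn
  obtain ⟨Z, hZc, hZ⟩ := exists_continuous_flow (b := fun x t => a (clamp ℓ x, clamp T t)) hT hK0
    (fun x => by fun_prop) (fun x t => hM _ (clampBox_mem hℓ hT (x, t)))
    (fun x y t => (hK _ (clamp_mem hℓ x) _ (clamp_mem hℓ y) _ (clamp_mem hT t)).trans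
      (mul_le_mul_of_nonneg_left (abs_clamp_sub_le _ _ _) hK0))
  refine ⟨Z, hZc, fun x hx t ht => ⟨(hZ x t ht).1, ?_⟩⟩
  have hsub : Icc 0 t ⊆ Icc 0 T := Icc_subset_Icc_right ht.2
  have hd : ∀ τ ∈ Icc 0 t, HasDerivWithinAt (fun σ => Z (σ, x, t))
      (a (clamp ℓ (Z (τ, x, t)), clamp T τ)) (Icc 0 t) τ := fun τ hτ =>
    ((hZ x t ht).2 τ (hsub hτ)).mono hsub
  have hmem := mem_Icc_of_outward (ℓ := ℓ) (b := fun x t => a (clamp ℓ x, clamp T t)) hd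
    (fun τ hτ => by
      simp only [clamp_of_mem (left_mem_Icc.2 hℓ), clamp_of_mem (hsub hτ), h0 τ (hsub hτ)])
    (fun τ hτ => by
      simp only [clamp_of_mem (right_mem_Icc.2 hℓ), clamp_of_mem (hsub hτ), h1 τ (hsub hτ)])
    (by simpa only [(hZ x t ht).1] using hx)
  refine fun τ hτ => ⟨hmem τ hτ, ?_⟩
  have := hd τ hτ
  rwa [clamp_of_mem (hmem τ hτ), clamp_of_mem (hsub hτ)] at this

/-! ### Linear equations along characteristics -/

/-- Duhamel's formula for the solution of `J' = c + b J`, `J 0 = 0`. -/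
noncomputable def duhamel (b c : ℝ → ℝ) (t : ℝ) : ℝ :=
  Real.exp (∫ σ in (0 : ℝ)..t, b σ) * ∫ τ in (0 : ℝ)..t, c τ * Real.exp (-∫ σ in (0 : ℝ)..τ, b σ)

lemma duhamel_zero (b c : ℝ → ℝ) : duhamel b c 0 = 0 := by simp [duhamel]

lemma hasDerivAt_duhamel {b c : ℝ → ℝ} (hb : Continuous b) (hc : Continuous c) (t : ℝ) :
    HasDerivAt (duhamel b c) (c t + b t * duhamel b c t) t := by
  have hB : ∀ t, HasDerivAt (fun t => ∫ σ in (0 : ℝ)..t, b σ) (b t) t := fun t =>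
    (hb.integral_hasStrictDerivAt 0 t).hasDerivAt
  have hBc : Continuous fun t => ∫ σ in (0 : ℝ)..t, b σ :=
    continuous_iff_continuousAt.2 fun t => (hB t).continuousAt
  have hcont : Continuous fun τ => c τ * Real.exp (-∫ σ in (0 : ℝ)..τ, b σ) := by fun_prop
  have h := (hB t).exp.mul (hcont.integral_hasStrictDerivAt 0 t).hasDerivAt
  refine h.congr_deriv ?_
  rw [duhamel, Real.exp_neg]
  field_simp
  ring

lemma duhamel_congr {b b' c c' : ℝ → ℝ} {t : ℝ} (ht : 0 ≤ t) (hb : EqOn b b' (Icc 0 t))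
    (hc : EqOn c c' (Icc 0 t)) : duhamel b c t = duhamel b' c' t := by
  have hB : ∀ s ∈ Icc 0 t, ∫ σ in (0 : ℝ)..s, b σ = ∫ σ in (0 : ℝ)..s, b' σ := fun s hs => by
    refine integral_congr fun σ hσ => hb ?_
    rw [uIcc_of_le hs.1] at hσ
    exact ⟨hσ.1, hσ.2.trans hs.2⟩
  rw [duhamel, duhamel, hB t (right_mem_Icc.2 ht)]
  congr 1
  refine integral_congr fun τ hτ => ?_
  rw [uIcc_of_le ht] at hτ
  simp only [hc hτ, hB τ hτ]

lemma continuous_duhamel {X : Type*} [TopologicalSpace X] {b c : X → ℝ → ℝ} {s : X → ℝ}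
    (hb : Continuous (Function.uncurry b)) (hc : Continuous (Function.uncurry c))
    (hs : Continuous s) : Continuous fun x => duhamel (b x) (c x) (s x) := by
  unfold duhamel
  refine ((continuous_parametric_intervalIntegral_of_continuous hb hs).rexp).mul
    (continuous_parametric_intervalIntegral_of_continuous ?_ hs)
  refine hc.mul (Real.continuous_exp.comp (Continuous.neg ?_))
  exact continuous_parametric_intervalIntegral_of_continuous (X := X × ℝ)
    (f := fun p σ => b p.1 σ) (by fun_prop) continuous_snd

/-- `u` satisfies `∂ₜ u + a ∂ₓ u = h` in the rectangle in the sense of characteristics: along each of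
them the derivative of `u` is `h`. No differentiability of `u` in other directions is assumed. -/
def IsTransported (ℓ T : ℝ) (a u h : ℝ × ℝ → ℝ) : Prop :=
  ∀ t ∈ Icc 0 T, ∀ Y : ℝ → ℝ, IsCharacteristic ℓ a t Y → ∀ τ ∈ Icc 0 t,
    HasDerivWithinAt (fun σ => u (Y σ, σ)) (h (Y τ, τ)) (Icc 0 t) τ

/-- Gain of one derivative for a transport equation. Suppose that `u` vanishes at `t = 0`, that its
derivative along characteristics is `h`, and that the increments of `h` are linear combinations of
those of `x` and `u` with continuous coefficients. For two characteristics `Y₁`, `Y₂` the increment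
`u (Y₁) - u (Y₂)` is then `Y₁ - Y₂` times the solution of a linear equation with continuous
coefficients, which still makes sense when the characteristics coincide. Hence `u` has a continuous
divided difference `Q`, and the derivative `Q (x, x, t)` of `u` satisfies a transport equation. -/
theorem IsTransported.exists_hasDivDiff {ℓ T : ℝ} (hℓ : 0 ≤ ℓ) (hT : 0 ≤ T)
    {a u h : ℝ × ℝ → ℝ} {α A₀ A₁ : ℝ × ℝ × ℝ → ℝ} (ha : Continuous a) (hα : HasDivDiff ℓ T a α)
    (h0 : ∀ t ∈ Icc 0 T, a (0, t) < 0) (h1 : ∀ t ∈ Icc 0 T, 0 < a (ℓ, t))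
    (hu : IsTransported ℓ T a u h) (hu0 : ∀ x ∈ Icc 0 ℓ, u (x, 0) = 0)
    (hA₀ : Continuous A₀) (hA₁ : Continuous A₁)
    (hh : ∀ x ∈ Icc 0 ℓ, ∀ y ∈ Icc 0 ℓ, ∀ t ∈ Icc 0 T, h (x, t) - h (y, t) =
      A₀ (x, y, t) * (x - y) + A₁ (x, y, t) * (u (x, t) - u (y, t))) :
    ∃ Q, HasDivDiff ℓ T u Q ∧ (∀ x, Q (x, x, 0) = 0) ∧
      IsTransported ℓ T a (fun p => Q (p.1, p.1, p.2))
        (fun p => A₀ (p.1, p.1, p.2) +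
          (A₁ (p.1, p.1, p.2) - α (p.1, p.1, p.2)) * Q (p.1, p.1, p.2)) := by
  obtain ⟨Z, hZc, hZ⟩ := exists_characteristic_flow hℓ hT ha hα h0 h1
  have hαc := hα.continuous
  set b : ℝ × ℝ × ℝ → ℝ → ℝ := fun p σ =>
    A₁ (Z (σ, p.1, p.2.2), Z (σ, p.2.1, p.2.2), σ) -
      α (Z (σ, p.1, p.2.2), Z (σ, p.2.1, p.2.2), σ) with hb
  set c : ℝ × ℝ × ℝ → ℝ → ℝ := fun p σ =>
    A₀ (Z (σ, p.1, p.2.2), Z (σ, p.2.1, p.2.2), σ) with hc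
  have hbc : Continuous (Function.uncurry b) := by simp only [hb]; fun_prop
  have hcc : Continuous (Function.uncurry c) := by simp only [hc]; fun_prop
  have hbp : ∀ p, Continuous (b p) := fun p => by simp only [hb]; fun_prop
  have hcp : ∀ p, Continuous (c p) := fun p => by simp only [hc]; fun_prop
  refine ⟨fun p => duhamel (b p) (c p) p.2.2, ⟨?_, ?_⟩, fun x => duhamel_zero _ _, ?_⟩
  · exact continuous_duhamel hbc hcc (by fun_prop)
  · intro x hx y hy t ht
    obtain ⟨hxt, hX⟩ := hZ x hx t ht
    obtain ⟨hyt, hY⟩ := hZ y hy t ht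
    set X : ℝ → ℝ := fun τ => Z (τ, x, t) with hXdef
    set Y : ℝ → ℝ := fun τ => Z (τ, y, t) with hYdef
    set J : ℝ → ℝ := duhamel (b (x, y, t)) (c (x, y, t)) with hJ
    have hsub : Icc 0 t ⊆ Icc 0 T := Icc_subset_Icc_right ht.2
    have hXc : Continuous X := by simp only [hXdef]; fun_prop
    have hYc : Continuous Y := by simp only [hYdef]; fun_prop
    obtain ⟨K, hK⟩ := (isCompact_Icc (a := (0 : ℝ)) (b := t)).exists_bound_of_continuousOn
      (f := fun τ => A₁ (X τ, Y τ, τ)) (by fun_prop)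
    -- The defect of the claimed formula solves a homogeneous linear equation.
    have hd : ∀ τ ∈ Icc 0 t, HasDerivWithinAt
        (fun τ => u (X τ, τ) - u (Y τ, τ) - (X τ - Y τ) * J τ)
        (A₁ (X τ, Y τ, τ) * (u (X τ, τ) - u (Y τ, τ) - (X τ - Y τ) * J τ)) (Icc 0 t) τ := by
      intro τ hτ
      have e1 := (hu t ht X hX τ hτ).sub (hu t ht Y hY τ hτ)
      have e2 := ((hX τ hτ).2.sub (hY τ hτ).2).mul
        (hasDerivAt_duhamel (hbp (x, y, t)) (hcp (x, y, t)) τ).hasDerivWithinAt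
      refine (e1.sub e2).congr_deriv ?_
      rw [hh _ (hX τ hτ).1 _ (hY τ hτ).1 τ (hsub hτ),
        hα.sub_eq _ (hX τ hτ).1 _ (hY τ hτ).1 τ (hsub hτ)]
      simp only [hb, hc, Pi.sub_apply]
      ring
    have hest := abs_sub_le_of_abs_deriv_sub_le hd (g := fun _ => 0) (g' := fun _ => 0) (K := K)
      (fun τ _ => hasDerivWithinAt_const _ _ _)
      (fun τ hτ => by
        rw [sub_zero, sub_zero, abs_mul]
        exact mul_le_mul_of_nonneg_right (hK τ hτ) (abs_nonneg _))
      (left_mem_Icc.2 ht.1) (right_mem_Icc.2 ht.1)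
    have hJ0 : J 0 = 0 := duhamel_zero _ _
    have hz := left_mem_Icc.2 ht.1
    simp only [hu0 _ (hX 0 hz).1, hu0 _ (hY 0 hz).1, hJ0, mul_zero, sub_zero, abs_zero] at hest
    have h3 := abs_eq_zero.1 (le_antisymm hest (abs_nonneg _))
    rw [show X t = x from hxt, show Y t = y from hyt] at h3
    linear_combination h3
  · intro t ht Y hY τ hτ
    have hYt := (hY t (right_mem_Icc.2 ht.1)).1
    have hsub : Icc 0 t ⊆ Icc 0 T := Icc_subset_Icc_right ht.2
    -- By uniqueness, the characteristics issuing backwards from points of `Y` all follow `Y`.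
    have hflow : ∀ s ∈ Icc 0 t, ∀ σ ∈ Icc 0 s, Z (σ, Y s, s) = Z (σ, Y t, t) := by
      intro s hs σ hσ
      have e1 := IsCharacteristic.eqOn hα (hsub hs) (hZ _ (hY s hs).1 s (hsub hs)).2
        (hY.mono hs.2) (hZ _ (hY s hs).1 s (hsub hs)).1 hσ
      have e2 := IsCharacteristic.eqOn hα ht (hZ _ hYt t ht).2 hY (hZ _ hYt t ht).1
        ⟨hσ.1, hσ.2.trans hs.2⟩
      exact e1.trans e2.symm
    have hYZ : ∀ s ∈ Icc 0 t, Z (s, Y t, t) = Y s := fun s hs => by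
      rw [← hflow s hs s (right_mem_Icc.2 hs.1), (hZ _ (hY s hs).1 s (hsub hs)).1]
    have hQ : ∀ s ∈ Icc 0 t, duhamel (b (Y s, Y s, s)) (c (Y s, Y s, s)) s =
        duhamel (b (Y t, Y t, t)) (c (Y t, Y t, t)) s := fun s hs =>
      duhamel_congr hs.1 (fun σ hσ => by simp only [hb, hflow s hs σ hσ])
        (fun σ hσ => by simp only [hc, hflow s hs σ hσ])
    refine ((hasDerivAt_duhamel (hbp (Y t, Y t, t))
      (hcp (Y t, Y t, t)) τ).hasDerivWithinAt.congr hQ (hQ τ hτ)).congr_deriv ?_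
    simp only [hQ τ hτ]
    simp only [hb, hc, hYZ τ hτ]

lemma hasFDerivWithinAt_of_tendsto {s : Set (ℝ × ℝ)} {u A B : ℝ × ℝ → ℝ} {p : ℝ × ℝ} {A' B' : ℝ}
    (hA : Tendsto A (𝓝[s] p) (𝓝 A')) (hB : Tendsto B (𝓝[s] p) (𝓝 B'))
    (h : ∀ q ∈ s, u q - u p = A q * (q.1 - p.1) + B q * (q.2 - p.2)) :
    HasFDerivWithinAt u
      (A' • ContinuousLinearMap.fst ℝ ℝ ℝ + B' • ContinuousLinearMap.snd ℝ ℝ ℝ) s p := by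
  rw [hasFDerivWithinAt_iff_isLittleO, Asymptotics.isLittleO_iff]
  intro c hc
  have hA' := Metric.tendsto_nhds.1 hA (c / 2) (half_pos hc)
  have hB' := Metric.tendsto_nhds.1 hB (c / 2) (half_pos hc)
  filter_upwards [hA', hB', self_mem_nhdsWithin] with q h1 h2 hq
  rw [Real.dist_eq] at h1 h2
  have e : u q - u p - (A' • ContinuousLinearMap.fst ℝ ℝ ℝ +
      B' • ContinuousLinearMap.snd ℝ ℝ ℝ) (q - p) =
      (A q - A') * (q.1 - p.1) + (B q - B') * (q.2 - p.2) := by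
    rw [h q hq]
    simp
    ring
  rw [e]
  have n1 : |q.1 - p.1| ≤ ‖q - p‖ := norm_fst_le (q - p)
  have n2 : |q.2 - p.2| ≤ ‖q - p‖ := norm_snd_le (q - p)
  calc |(A q - A') * (q.1 - p.1) + (B q - B') * (q.2 - p.2)|
      ≤ |A q - A'| * |q.1 - p.1| + |B q - B'| * |q.2 - p.2| := by
        rw [← abs_mul, ← abs_mul]; exact abs_add_le _ _
    _ ≤ c / 2 * ‖q - p‖ + c / 2 * ‖q - p‖ := by gcongr
    _ = c * ‖q - p‖ := by ring

/-- A transported function with a continuous divided difference in `x` is differentiable in both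
variables jointly. -/
theorem IsTransported.hasFDerivWithinAt {ℓ T : ℝ} (hℓ : 0 ≤ ℓ) (hT : 0 ≤ T)
    {a u h : ℝ × ℝ → ℝ} {α Q : ℝ × ℝ × ℝ → ℝ} (ha : Continuous a) (hα : HasDivDiff ℓ T a α)
    (h0 : ∀ t ∈ Icc 0 T, a (0, t) < 0) (h1 : ∀ t ∈ Icc 0 T, 0 < a (ℓ, t))
    (hu : IsTransported ℓ T a u h) (hh : Continuous h) (hQ : HasDivDiff ℓ T u Q) {p : ℝ × ℝ}
    (hp : p ∈ Icc 0 ℓ ×ˢ Icc 0 T) :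
    HasFDerivWithinAt u (Q (p.1, p.1, p.2) • ContinuousLinearMap.fst ℝ ℝ ℝ +
      (h p - Q (p.1, p.1, p.2) * a p) • ContinuousLinearMap.snd ℝ ℝ ℝ)
      (Icc 0 ℓ ×ˢ Icc 0 T) p := by
  obtain ⟨Z, hZc, hZ⟩ := exists_characteristic_flow hℓ hT ha hα h0 h1
  have hQc := hQ.continuous
  obtain ⟨x, t⟩ := p
  obtain ⟨hx, ht⟩ := hp
  simp only at hx ht
  -- The mean value theorem along the characteristic that is at `x` at time `t₂`.
  set Ψ : ℝ × ℝ × ℝ → ℝ := fun z => h (Z (z.1, x, z.2.2), z.1) -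
    Q (Z (z.2.1, x, z.2.2), x, z.2.1) * a (Z (z.1, x, z.2.2), z.1) with hΨ
  have hΨc : Continuous Ψ := by simp only [hΨ]; fun_prop
  have hmvt : ∀ t₁ ∈ Icc 0 T, ∀ t₂ ∈ Icc 0 T, t₁ < t₂ → ∃ ξ ∈ Icc t₁ t₂,
      u (x, t₂) - u (x, t₁) = Ψ (ξ, t₁, t₂) * (t₂ - t₁) := by
    intro t₁ ht₁ t₂ ht₂ hlt
    obtain ⟨hYt, hY⟩ := hZ x hx t₂ ht₂
    set Y : ℝ → ℝ := fun τ => Z (τ, x, t₂) with hYdef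
    have hYt : Y t₂ = x := hYt
    have hd : ∀ τ ∈ Icc 0 t₂, HasDerivWithinAt
        (fun τ => u (Y τ, τ) - Q (Y t₁, x, t₁) * Y τ) (Ψ (τ, t₁, t₂)) (Icc 0 t₂) τ := fun τ hτ =>
      (hu t₂ ht₂ Y hY τ hτ).sub ((hY τ hτ).2.const_mul _)
    have hsub : Icc t₁ t₂ ⊆ Icc 0 t₂ := Icc_subset_Icc_left ht₁.1
    obtain ⟨ξ, hξ, hξeq⟩ := exists_hasDerivAt_eq_slope
      (fun τ => u (Y τ, τ) - Q (Y t₁, x, t₁) * Y τ) (fun τ => Ψ (τ, t₁, t₂)) hlt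
      (fun τ hτ => (hd τ (hsub hτ)).continuousWithinAt.mono hsub)
      (fun τ hτ => (hd τ (hsub (Ioo_subset_Icc_self hτ))).hasDerivAt
        (Icc_mem_nhds (ht₁.1.trans_lt hτ.1) hτ.2))
    refine ⟨ξ, Ioo_subset_Icc_self hξ, ?_⟩
    rw [hξeq, div_mul_cancel₀ _ (sub_pos.2 hlt).ne', hYt]
    have := hQ.sub_eq _ (hY t₁ ⟨ht₁.1, hlt.le⟩).1 x hx t₁ ht₁
    linear_combination this
  have hB : ∀ s : ℝ, ∃ B : ℝ, s ∈ Icc 0 T → u (x, s) - u (x, t) = B * (s - t) ∧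
      ∃ ξ ∈ Icc (min s t) (max s t), B = Ψ (ξ, min s t, max s t) := by
    intro s
    by_cases hs : s ∈ Icc 0 T
    · rcases lt_trichotomy s t with hst | rfl | hst
      · obtain ⟨ξ, hξ, h⟩ := hmvt s hs t ht hst
        refine ⟨_, fun _ => ⟨?_, ξ, ?_, rfl⟩⟩
        · rw [min_eq_left hst.le, max_eq_right hst.le]
          linear_combination -h
        · rwa [min_eq_left hst.le, max_eq_right hst.le]
      · exact ⟨Ψ (s, min s s, max s s), fun _ => ⟨by simp, s, by simp, rfl⟩⟩
      · obtain ⟨ξ, hξ, h⟩ := hmvt t ht s hs hst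
        refine ⟨_, fun _ => ⟨?_, ξ, ?_, rfl⟩⟩
        · rw [min_eq_right hst.le, max_eq_left hst.le]
          exact h
        · rwa [min_eq_right hst.le, max_eq_left hst.le]
    · exact ⟨0, fun h => absurd h hs⟩
  choose B hB using hB
  have hBlim : Tendsto (fun q : ℝ × ℝ => B q.2) (𝓝[Icc 0 ℓ ×ˢ Icc 0 T] (x, t))
      (𝓝 (Ψ (t, t, t))) := by
    refine Metric.tendsto_nhds.2 fun ε hε => ?_
    obtain ⟨δ, hδ, hδε⟩ := Metric.continuousAt_iff.1 hΨc.continuousAt ε hε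
    filter_upwards [self_mem_nhdsWithin,
      mem_nhdsWithin_of_mem_nhds (Metric.ball_mem_nhds _ hδ)] with q hq hqδ
    obtain ⟨-, ξ, hξ, hBeq⟩ := hB q.2 hq.2
    rw [hBeq]
    have hqt : |q.2 - t| < δ := by
      have : dist q (x, t) < δ := hqδ
      rw [Prod.dist_eq] at this
      exact (le_max_right _ _).trans_lt this
    obtain ⟨hl, hr⟩ := abs_lt.1 hqt
    have hmin : t - δ < min q.2 t := lt_min (by linarith) (by linarith)
    have hmax : max q.2 t < t + δ := max_lt (by linarith) (by linarith)
    apply hδε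
    simp only [Prod.dist_eq, Real.dist_eq, max_lt_iff, abs_lt]
    refine ⟨⟨?_, ?_⟩, ⟨?_, ?_⟩, ?_, ?_⟩ <;> linarith [hξ.1, hξ.2]
  have hΨt : Ψ (t, t, t) = h (x, t) - Q (x, x, t) * a (x, t) := by
    simp only [hΨ, (hZ x hx t ht).1]
  rw [hΨt] at hBlim
  refine hasFDerivWithinAt_of_tendsto (A := fun q => Q (q.1, x, q.2)) ?_ hBlim ?_
  · have : Continuous fun q : ℝ × ℝ => Q (q.1, x, q.2) := by fun_prop
    exact (this.tendsto (x, t)).mono_left nhdsWithin_le_nhds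
  · rintro ⟨y, s⟩ ⟨hy, hs⟩
    have e1 := hQ.sub_eq y hy x hx s hs
    have e2 := (hB s hs).1
    simp only
    linear_combination e1 + e2

/-! ### Second derivatives of solutions of quasilinear equations -/

lemma contDiffOn_one_of_hasFDerivWithinAt {s : Set (ℝ × ℝ)} (hs : UniqueDiffOn ℝ s)
    {u : ℝ × ℝ → ℝ} {u' : ℝ × ℝ → ℝ × ℝ →L[ℝ] ℝ} {n : ℕ}
    (h : ∀ p ∈ s, HasFDerivWithinAt u (u' p) s p) (hc : ContDiffOn ℝ n u' s) :
    ContDiffOn ℝ (n + 1) u s :=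
  (contDiffOn_succ_iff_fderivWithin hs).2 ⟨fun p hp => (h p hp).differentiableWithinAt, by simp,
    hc.congr fun p hp => (h p hp).fderivWithin (hs p hp)⟩

/-- The chain rule for the `x`-derivative of `F (W (x, t), x, t)`. -/
lemma fderivWithin_comp_graph {ℓ T : ℝ} (hℓ : 0 < ℓ) (hT : 0 < T) {W : ℝ × ℝ → ℝ}
    {F : ℝ × ℝ × ℝ → ℝ} {p : ℝ × ℝ} (hp : p ∈ Icc 0 ℓ ×ˢ Icc 0 T)
    (hW : DifferentiableWithinAt ℝ W (Icc 0 ℓ ×ˢ Icc 0 T) p)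
    (hF : DifferentiableWithinAt ℝ F (univ ×ˢ (Icc 0 ℓ ×ˢ Icc 0 T)) (W p, p)) (v : ℝ × ℝ) :
    fderivWithin ℝ (fun q => F (W q, q)) (Icc 0 ℓ ×ˢ Icc 0 T) p v =
      fderivWithin ℝ F (univ ×ˢ (Icc 0 ℓ ×ˢ Icc 0 T)) (W p, p) (1, 0) *
          fderivWithin ℝ W (Icc 0 ℓ ×ˢ Icc 0 T) p v +
        fderivWithin ℝ F (univ ×ˢ (Icc 0 ℓ ×ˢ Icc 0 T)) (W p, p) (0, v) := by
  have h := (hF.hasFDerivWithinAt.comp (f := fun q => (W q, q)) p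
    (hW.hasFDerivWithinAt.prodMk (hasFDerivWithinAt_id p _)) fun q hq => ⟨mem_univ _, hq⟩)
  have e := h.fderivWithin (uniqueDiffOn_box hℓ hT p hp)
  simp only [Function.comp_def] at e
  rw [e]
  set L := fderivWithin ℝ F (univ ×ˢ (Icc 0 ℓ ×ˢ Icc 0 T)) (W p, p)
  set w := fderivWithin ℝ W (Icc 0 ℓ ×ˢ Icc 0 T) p v with hw
  have : (w, v) = w • ((1, 0) : ℝ × ℝ × ℝ) + (0, v) := by simp
  calc _ = L (w, v) := rfl
    _ = _ := by rw [this, map_add, map_smul, smul_eq_mul, mul_comm]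

/-- A classical solution of `∂ₜ W + Λ (W, x, t) ∂ₓ W = F (W, x, t)` with zero initial values and `C²`
coefficients is `C²` up to the boundary, if all characteristics leave the rectangle through its two
sides. The gain of one derivative for transport equations applies to `W`, and then to `∂ₓ W`, which
satisfies a transport equation whose right-hand side is quadratic in `∂ₓ W`. -/
theorem contDiffOn_two_of_transport {ℓ T : ℝ} (hℓ : 0 < ℓ) (hT : 0 < T) {W : ℝ × ℝ → ℝ}
    {Λ F : ℝ × ℝ × ℝ → ℝ} (hW : ContDiffOn ℝ 1 W (Icc 0 ℓ ×ˢ Icc 0 T))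
    (hΛ : ContDiffOn ℝ 2 Λ (univ ×ˢ (Icc 0 ℓ ×ˢ Icc 0 T)))
    (hF : ContDiffOn ℝ 2 F (univ ×ˢ (Icc 0 ℓ ×ˢ Icc 0 T)))
    (h0 : ∀ t ∈ Icc 0 T, Λ (W (0, t), 0, t) < 0) (h1 : ∀ t ∈ Icc 0 T, 0 < Λ (W (ℓ, t), ℓ, t))
    (hini : ∀ x ∈ Icc 0 ℓ, W (x, 0) = 0)
    (heq : ∀ p ∈ Icc 0 ℓ ×ˢ Icc 0 T, fderivWithin ℝ W (Icc 0 ℓ ×ˢ Icc 0 T) p (0, 1) +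
      Λ (W p, p) * fderivWithin ℝ W (Icc 0 ℓ ×ˢ Icc 0 T) p (1, 0) = F (W p, p)) :
    ContDiffOn ℝ 2 W (Icc 0 ℓ ×ˢ Icc 0 T) := by
  set B : Set (ℝ × ℝ) := Icc 0 ℓ ×ˢ Icc 0 T with hB
  set S : Set (ℝ × ℝ × ℝ) := univ ×ˢ B with hS
  have hBu : UniqueDiffOn ℝ B := uniqueDiffOn_box hℓ hT
  have hSu : UniqueDiffOn ℝ S := uniqueDiffOn_univ.prod hBu
  have hgraph : ContDiffOn ℝ 1 (fun p => (W p, p)) B := hW.prodMk contDiffOn_id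
  have hmaps : MapsTo (fun p => (W p, p)) B S := fun p hp => ⟨mem_univ _, hp⟩
  have hlift : ∀ {f : ℝ × ℝ × ℝ → ℝ}, ContDiffOn ℝ 1 f S → ContDiffOn ℝ 1 (fun p => f (W p, p)) B :=
    fun hf => hf.comp hgraph hmaps
  have hpartial : ∀ {f : ℝ × ℝ × ℝ → ℝ}, ContDiffOn ℝ 2 f S → ∀ v,
      ContDiffOn ℝ 1 (fun p => fderivWithin ℝ f S (W p, p) v) B := fun hf v =>
    hlift ((hf.fderivWithin hSu (by norm_num)).clm_apply contDiffOn_const)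
  have hA : ContDiffOn ℝ 1 (fun p => Λ (W p, p)) B := hlift (hΛ.of_le (by norm_num))
  have hf : ContDiffOn ℝ 1 (fun p => F (W p, p)) B := hlift (hF.of_le (by norm_num))
  have hdW : ∀ p ∈ B, DifferentiableWithinAt ℝ W B p := hW.differentiableOn one_ne_zero
  have hdΛ : ∀ p ∈ S, DifferentiableWithinAt ℝ Λ S p := hΛ.differentiableOn two_ne_zero
  have hdF : ∀ p ∈ S, DifferentiableWithinAt ℝ F S p := hF.differentiableOn two_ne_zero
  -- Constant extension beyond the rectangle makes the coefficients globally continuous.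
  have hac := continuous_comp_clampBox hℓ.le hT.le hA.continuousOn
  have hfc := continuous_comp_clampBox hℓ.le hT.le hf.continuousOn
  set a : ℝ × ℝ → ℝ := fun p => Λ (W (clampBox ℓ T p), clampBox ℓ T p) with ha
  set f : ℝ × ℝ → ℝ := fun p => F (W (clampBox ℓ T p), clampBox ℓ T p) with hfdef
  have haB : ∀ p ∈ B, a p = Λ (W p, p) := fun p hp => by simp only [ha, clampBox_of_mem hp]
  have hfB : ∀ p ∈ B, f p = F (W p, p) := fun p hp => by simp only [hfdef, clampBox_of_mem hp]
  obtain ⟨α, hα, hαd⟩ := exists_hasDivDiff hℓ hT (hA.congr haB)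
  obtain ⟨γ, hγ, hγd⟩ := exists_hasDivDiff hℓ hT (hf.congr hfB)
  have ha0 : ∀ t ∈ Icc 0 T, a (0, t) < 0 := fun t ht => by
    rw [haB (0, t) ⟨left_mem_Icc.2 hℓ.le, ht⟩]; exact h0 t ht
  have ha1 : ∀ t ∈ Icc 0 T, 0 < a (ℓ, t) := fun t ht => by
    rw [haB (ℓ, t) ⟨right_mem_Icc.2 hℓ.le, ht⟩]; exact h1 t ht
  have hWtr : IsTransported ℓ T a W f := by
    intro t ht Y hY τ hτ
    have hmem : (Y τ, τ) ∈ B := ⟨(hY τ hτ).1, hτ.1, hτ.2.trans ht.2⟩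
    have h := (hdW _ hmem).hasFDerivWithinAt.comp_hasDerivWithinAt (f := fun σ => (Y σ, σ)) τ
      ((hY τ hτ).2.prodMk (hasDerivWithinAt_id τ _))
      (fun σ hσ => ⟨(hY σ hσ).1, hσ.1, hσ.2.trans ht.2⟩)
    refine h.congr_deriv ?_
    have : ((a (Y τ, τ), 1) : ℝ × ℝ) = a (Y τ, τ) • ((1, 0) : ℝ × ℝ) + (0, 1) := by simp
    rw [this, map_add, map_smul, smul_eq_mul, hfB _ hmem, haB _ hmem, ← heq _ hmem, add_comm]
  obtain ⟨Q, hQ, hQ0, hqtr⟩ := hWtr.exists_hasDivDiff hℓ.le hT.le (A₀ := γ) (A₁ := fun _ => 0)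
    hac hα ha0 ha1 hini hγ.continuous continuous_const
    (fun x hx y hy t ht => by rw [hγ.sub_eq x hx y hy t ht, zero_mul, add_zero])
  have hQc := hQ.continuous
  have hγc := hγ.continuous
  have hαc := hα.continuous
  set q : ℝ × ℝ → ℝ := fun p => Q (p.1, p.1, p.2) with hq
  set H : ℝ × ℝ → ℝ := fun p => γ (p.1, p.1, p.2) + (0 - α (p.1, p.1, p.2)) * q p with hH
  have hWd : ∀ p ∈ B, HasFDerivWithinAt W (q p • ContinuousLinearMap.fst ℝ ℝ ℝ +
      (f p - q p * a p) • ContinuousLinearMap.snd ℝ ℝ ℝ) B p := fun p hp =>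
    hWtr.hasFDerivWithinAt hℓ.le hT.le hac hα ha0 ha1 hfc hQ hp
  have hWx : ∀ p ∈ B, fderivWithin ℝ W B p (1, 0) = q p := fun p hp => by
    rw [(hWd p hp).fderivWithin (hBu p hp)]; simp
  -- The transport equation for `q = ∂ₓ W` in terms of the derivatives of `Λ` and `F`.
  have hB0 := hpartial hF (0, 1, 0)
  have hB1 := (hpartial hF (1, 0)).sub (hpartial hΛ (0, 1, 0))
  have hB2 := (hpartial hΛ (1, 0)).neg
  set b₀ : ℝ × ℝ → ℝ := fun p => fderivWithin ℝ F S (W p, p) (0, 1, 0) with hb₀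
  set b₁ : ℝ × ℝ → ℝ := fun p => fderivWithin ℝ F S (W p, p) (1, 0) -
    fderivWithin ℝ Λ S (W p, p) (0, 1, 0) with hb₁
  set b₂ : ℝ × ℝ → ℝ := fun p => -fderivWithin ℝ Λ S (W p, p) (1, 0) with hb₂
  have hHB : ∀ p ∈ B, H p = b₀ p + b₁ p * q p + b₂ p * q p ^ 2 := by
    rintro ⟨x, t⟩ hp
    have e1 := hγd x hp.1 t hp.2
    rw [fderivWithin_congr hfB (hfB (x, t) hp),
      fderivWithin_comp_graph hℓ hT hp (hdW _ hp) (hdF _ (hmaps hp)), hWx _ hp] at e1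
    have e2 := hαd x hp.1 t hp.2
    rw [fderivWithin_congr haB (haB (x, t) hp),
      fderivWithin_comp_graph hℓ hT hp (hdW _ hp) (hdΛ _ (hmaps hp)), hWx _ hp] at e2
    simp only [hH, hb₀, hb₁, hb₂, e1, e2]
    ring
  obtain ⟨β₀, hβ₀, -⟩ := exists_hasDivDiff hℓ hT hB0
  obtain ⟨β₁, hβ₁, -⟩ := exists_hasDivDiff hℓ hT hB1
  obtain ⟨β₂, hβ₂, -⟩ := exists_hasDivDiff hℓ hT hB2
  have hβ₀c := hβ₀.continuous
  have hβ₁c := hβ₁.continuous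
  have hβ₂c := hβ₂.continuous
  have hb₁c := continuous_comp_clampBox hℓ.le hT.le hB1.continuousOn
  have hb₂c := continuous_comp_clampBox hℓ.le hT.le hB2.continuousOn
  have hqc : Continuous q := by simp only [hq]; fun_prop
  obtain ⟨R, hR, -, -⟩ := hqtr.exists_hasDivDiff hℓ.le hT.le
    (A₀ := fun z => β₀ z + β₁ z * q (z.1, z.2.2) + β₂ z * q (z.1, z.2.2) ^ 2)
    (A₁ := fun z => b₁ (clampBox ℓ T z.2) + b₂ (clampBox ℓ T z.2) * (q (z.1, z.2.2) + q z.2))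
    hac hα ha0 ha1 (fun x _ => hQ0 x) (by fun_prop)
    ((hb₁c.comp continuous_snd).add ((hb₂c.comp continuous_snd).mul (by fun_prop))) (by
      intro x hx y hy t ht
      have e := hHB (x, t) ⟨hx, ht⟩
      have e' := hHB (y, t) ⟨hy, ht⟩
      have c : clampBox ℓ T (y, t) = (y, t) := clampBox_of_mem ⟨hy, ht⟩
      have d0 := hβ₀.sub_eq x hx y hy t ht
      have d1 := hβ₁.sub_eq x hx y hy t ht
      have d2 := hβ₂.sub_eq x hx y hy t ht
      rw [e, e']
      simp only [c]
      linear_combination d0 + q (x, t) * d1 + q (x, t) ^ 2 * d2)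
  have hRc := hR.continuous
  have hHc : Continuous H := by simp only [hH]; fun_prop
  have hq1 : ContDiffOn ℝ 1 q B := by
    have := contDiffOn_one_of_hasFDerivWithinAt (n := 0) hBu (fun p hp =>
      hqtr.hasFDerivWithinAt hℓ.le hT.le hac hα ha0 ha1 hHc hR hp)
      (contDiffOn_zero.2 (Continuous.continuousOn (by fun_prop)))
    simpa using this
  have := contDiffOn_one_of_hasFDerivWithinAt (n := 1) hBu hWd
    ((hq1.smul contDiffOn_const).add
      ((((hf.congr hfB).sub (hq1.mul (hA.congr haB)))).smul contDiffOn_const))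
  exact this.of_le (by norm_num)

/-! ### Vanishing near the inflow side -/

lemma nonneg_of_hasDerivWithinAt_of_le {f : ℝ → ℝ} {d b t : ℝ} (ht : t ∈ Ioc 0 b)
    (hf : HasDerivWithinAt f d (Icc 0 b) t) (hle : ∀ s ∈ Ico 0 t, f s ≤ f t) : 0 ≤ d := by
  have h := hasDerivWithinAt_iff_tendsto_slope.1 (hf.mono
    (Ico_subset_Icc_self.trans (Icc_subset_Icc_right ht.2)) : HasDerivWithinAt f d (Ico 0 t) t)
  rw [sdiff_singleton_eq_self right_notMem_Ico] at h
  have := right_nhdsWithin_Ico_neBot ht.1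
  refine ge_of_tendsto h ?_
  filter_upwards [self_mem_nhdsWithin] with s hs
  rw [slope_def_field]
  exact div_nonneg_of_nonpos (by linarith [hle s hs]) (by linarith [hs.2])

/-- If the field does not point to the left in a strip `0 ≤ x ≤ ε` and the equation there is
homogeneous, a solution with zero inflow and initial data vanishes in the strip. Otherwise
`W² exp (-2 (K + 1) t)`, where `K` bounds the zero-order coefficient, has a positive maximum over
the strip, and at a maximum point its derivative along the field is both nonnegative and negative. -/
lemma eq_zero_of_homogeneous_strip {ℓ T ε : ℝ} (hε : 0 ≤ ε) (hεℓ : ε ≤ ℓ) (hT : 0 ≤ T)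
    {W A m : ℝ × ℝ → ℝ} (hW : DifferentiableOn ℝ W (Icc 0 ℓ ×ˢ Icc 0 T))
    (hm : ContinuousOn m (Icc 0 ℓ ×ˢ Icc 0 T))
    (hA : ∀ p ∈ Icc 0 ℓ ×ˢ Icc 0 T, p.1 ≤ ε → 0 ≤ A p)
    (heq : ∀ p ∈ Icc 0 ℓ ×ˢ Icc 0 T, p.1 ≤ ε →
      fderivWithin ℝ W (Icc 0 ℓ ×ˢ Icc 0 T) p (0, 1) +
        A p * fderivWithin ℝ W (Icc 0 ℓ ×ˢ Icc 0 T) p (1, 0) = W p * m p)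
    (hini : ∀ x ∈ Icc 0 ℓ, W (x, 0) = 0) (hbd : ∀ t ∈ Icc 0 T, W (0, t) = 0) :
    ∀ p ∈ Icc 0 ℓ ×ˢ Icc 0 T, p.1 ≤ ε → W p = 0 := by
  obtain ⟨K, hK⟩ := (isCompact_Icc.prod isCompact_Icc :
    IsCompact (Icc 0 ℓ ×ˢ Icc 0 T)).exists_bound_of_continuousOn hm
  set z : ℝ × ℝ → ℝ := fun p => W p ^ 2 * Real.exp (-2 * (K + 1) * p.2) with hz
  have hzc : ContinuousOn z (Icc 0 ℓ ×ˢ Icc 0 T) :=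
    (hW.continuousOn.pow 2).mul (Continuous.continuousOn (by fun_prop))
  have hsub : Icc 0 ε ×ˢ Icc 0 T ⊆ Icc 0 ℓ ×ˢ Icc 0 T :=
    prod_mono_left (Icc_subset_Icc_right hεℓ)
  obtain ⟨⟨x, t⟩, hp, hmax⟩ := (isCompact_Icc.prod isCompact_Icc).exists_isMaxOn
    ⟨(0, 0), left_mem_Icc.2 hε, left_mem_Icc.2 hT⟩ (hzc.mono hsub)
  have hmax : ∀ q ∈ Icc 0 ε ×ˢ Icc 0 T, z q ≤ z (x, t) := fun q hq => hmax hq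
  suffices hWp : W (x, t) = 0 by
    intro q hq hqε
    have h := hmax q ⟨⟨hq.1.1, hqε⟩, hq.2⟩
    simp only [hz, hWp, ne_eq, OfNat.ofNat_ne_zero, not_false_eq_true, zero_pow, zero_mul] at h
    exact pow_eq_zero_iff two_ne_zero |>.1 (le_antisymm
      (nonpos_of_mul_nonpos_left h (Real.exp_pos _)) (sq_nonneg _))
  by_contra hne
  have hpB := hsub hp
  have hx0 : 0 < x := lt_of_le_of_ne hp.1.1 fun h => hne (by rw [← h]; exact hbd t hp.2)
  have ht0 : 0 < t := lt_of_le_of_ne hp.2.1 fun h => hne (by rw [← h]; exact hini x hpB.1)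
  have hd := (hW (x, t) hpB).hasFDerivWithinAt
  have hdx : HasDerivWithinAt (fun y => z (y, t)) _ (Icc 0 ℓ) x :=
    ((hasDerivWithinAt_fst_of_hasFDerivWithinAt hpB.2 hd).pow 2).mul_const
      (Real.exp (-2 * (K + 1) * t))
  have hexp : HasDerivWithinAt (fun τ => Real.exp (-2 * (K + 1) * τ))
      (Real.exp (-2 * (K + 1) * t) * (-2 * (K + 1))) (Icc 0 T) t := by
    simpa using (((hasDerivAt_id t).const_mul (-2 * (K + 1))).exp).hasDerivWithinAt
  have hdt : HasDerivWithinAt (fun τ => z (x, τ)) _ (Icc 0 T) t :=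
    ((hasDerivWithinAt_snd_of_hasFDerivWithinAt hpB.1 hd).pow 2).mul hexp
  have h1 := nonneg_of_hasDerivWithinAt_of_le ⟨hx0, hpB.1.2⟩ hdx fun y hy =>
    hmax (y, t) ⟨⟨hy.1, hy.2.le.trans hp.1.2⟩, hp.2⟩
  have h2 := nonneg_of_hasDerivWithinAt_of_le ⟨ht0, hpB.2.2⟩ hdt fun τ hτ =>
    hmax (x, τ) ⟨hp.1, ⟨hτ.1, hτ.2.le.trans hp.2.2⟩⟩
  have h3 := mul_nonneg (hA _ hpB hp.1.2) h1
  have h4 := heq _ hpB hp.1.2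
  have hmK : m (x, t) ≤ K := (le_abs_self _).trans (hK _ hpB)
  have hE := Real.exp_pos (-2 * (K + 1) * t)
  have hW2 : 0 < W (x, t) ^ 2 := by positivity
  simp only [Nat.cast_ofNat, Nat.add_one_sub_one, pow_one, Pi.pow_apply] at h2 h3
  set E := Real.exp (-2 * (K + 1) * t)
  set Wx := fderivWithin ℝ W (Icc 0 ℓ ×ˢ Icc 0 T) (x, t) (1, 0)
  set Wt := fderivWithin ℝ W (Icc 0 ℓ ×ˢ Icc 0 T) (x, t) (0, 1)
  have h5 : 0 ≤ E * W (x, t) ^ 2 * (2 * (m (x, t) - (K + 1))) := by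
    have : E * W (x, t) ^ 2 * (2 * (m (x, t) - (K + 1))) =
        (2 * W (x, t) * Wt * E + W (x, t) ^ 2 * (E * (-2 * (K + 1)))) +
          A (x, t) * (2 * W (x, t) * Wx * E) := by
      linear_combination (-2 * E * W (x, t)) * h4
    rw [this]
    exact add_nonneg h2 h3
  have h6 : E * W (x, t) ^ 2 * (2 * (m (x, t) - (K + 1))) < 0 :=
    mul_neg_of_pos_of_neg (mul_pos hE hW2) (by linarith)
  exact absurd h5 (not_le.2 h6)

lemma exists_pos_strip {ℓ T δ : ℝ} (hℓ : 0 < ℓ) (hT : 0 ≤ T) (hδ : 0 < δ) {A : ℝ × ℝ → ℝ}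
    (hA : ContinuousOn A (Icc 0 ℓ ×ˢ Icc 0 T)) (hpos : ∀ t ∈ Icc 0 T, 0 < A (0, t)) :
    ∃ ε, 0 < ε ∧ ε ≤ ℓ ∧ ε ≤ δ ∧ ∀ p ∈ Icc 0 ℓ ×ˢ Icc 0 T, p.1 ≤ ε → 0 < A p := by
  have h0 := left_mem_Icc.2 hℓ.le
  obtain ⟨t₀, ht₀, hmin⟩ := isCompact_Icc.exists_isMinOn (nonempty_Icc.2 hT)
    (hA.comp (f := fun t => ((0 : ℝ), t)) (by fun_prop) fun t ht => ⟨h0, ht⟩)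
  have hev := eventually_forall_norm_sub_le isCompact_Icc (Φ := fun x t => A (x, t)) hA h0
    (half_pos (hpos t₀ ht₀))
  obtain ⟨r, hr, hball⟩ := Metric.mem_nhdsWithin_iff.1 hev
  refine ⟨min (r / 2) (min ℓ δ), lt_min (half_pos hr) (lt_min hℓ hδ),
    (min_le_right _ _).trans (min_le_left _ _), (min_le_right _ _).trans (min_le_right _ _), ?_⟩
  rintro ⟨x, t⟩ ⟨hx, ht⟩ hxε
  have hxr : x ∈ Metric.ball (0 : ℝ) r := by
    rw [Metric.mem_ball, Real.dist_eq, sub_zero, abs_of_nonneg hx.1]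
    have := hxε.trans (min_le_left _ _)
    simp only at this
    linarith
  have h1 : |A (x, t) - A (0, t)| ≤ A (0, t₀) / 2 := hball ⟨hxr, hx⟩ t ht
  have h2 : A (0, t₀) ≤ A (0, t) := hmin ht
  linarith [(abs_le.1 h1).1, hpos t₀ ht₀]

/-- Second derivatives for the mixed problem with zero data. At the inflow side `x = 0` the source
term is proportional to the unknown, so that the solution vanishes in a strip along that side; there
the coefficient `Λ` may be altered freely, so as to make all characteristics leave the rectangle. -/
theorem contDiffOn_two_of_inflow {ℓ T δ : ℝ} (hℓ : 0 < ℓ) (hT : 0 < T) (hδ : 0 < δ)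
    {W : ℝ × ℝ → ℝ} {Λ F m : ℝ × ℝ × ℝ → ℝ} (hW : ContDiffOn ℝ 1 W (Icc 0 ℓ ×ˢ Icc 0 T))
    (hΛ : ContDiffOn ℝ 2 Λ (univ ×ˢ (Icc 0 ℓ ×ˢ Icc 0 T)))
    (hF : ContDiffOn ℝ 2 F (univ ×ˢ (Icc 0 ℓ ×ˢ Icc 0 T)))
    (hm : ContinuousOn m (univ ×ˢ (Icc 0 ℓ ×ˢ Icc 0 T)))
    (hFm : ∀ s, ∀ x ∈ Icc 0 ℓ, x ≤ δ → ∀ t ∈ Icc 0 T, F (s, x, t) = s * m (s, x, t))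
    (h0 : ∀ t ∈ Icc 0 T, 0 < Λ (W (0, t), 0, t)) (h1 : ∀ t ∈ Icc 0 T, 0 < Λ (W (ℓ, t), ℓ, t))
    (hini : ∀ x ∈ Icc 0 ℓ, W (x, 0) = 0) (hbd : ∀ t ∈ Icc 0 T, W (0, t) = 0)
    (heq : ∀ p ∈ Icc 0 ℓ ×ˢ Icc 0 T, fderivWithin ℝ W (Icc 0 ℓ ×ˢ Icc 0 T) p (0, 1) +
      Λ (W p, p) * fderivWithin ℝ W (Icc 0 ℓ ×ˢ Icc 0 T) p (1, 0) = F (W p, p)) :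
    ContDiffOn ℝ 2 W (Icc 0 ℓ ×ˢ Icc 0 T) := by
  have hgraph : ContinuousOn (fun p => (W p, p)) (Icc 0 ℓ ×ˢ Icc 0 T) :=
    hW.continuousOn.prodMk continuousOn_id
  have hmaps : MapsTo (fun p => (W p, p)) (Icc 0 ℓ ×ˢ Icc 0 T)
      (univ ×ˢ (Icc 0 ℓ ×ˢ Icc 0 T)) := fun p hp => ⟨mem_univ _, hp⟩
  obtain ⟨ε, hε, hεℓ, hεδ, hpos⟩ := exists_pos_strip hℓ hT.le hδ
    (hΛ.continuousOn.comp hgraph hmaps) h0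
  have hzero := eq_zero_of_homogeneous_strip hε.le hεℓ hT.le (A := fun p => Λ (W p, p))
    (m := fun p => m (W p, p)) (hW.differentiableOn one_ne_zero) (hm.comp hgraph hmaps)
    (fun p hp hpε => (hpos p hp hpε).le)
    (fun p hp hpε => (heq p hp).trans (hFm _ _ hp.1 (hpε.trans hεδ) _ hp.2)) hini hbd
  set χ : ℝ → ℝ := fun x => Real.smoothTransition (x / ε) with hχ
  have hχc : ContDiff ℝ 2 fun z : ℝ × ℝ × ℝ => χ z.2.1 :=
    (Real.smoothTransition.contDiff (n := 2)).comp (by fun_prop)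
  have hχ0 : χ 0 = 0 := Real.smoothTransition.zero_of_nonpos (by simp)
  have hχ1 : ∀ x, ε ≤ x → χ x = 1 := fun x hx =>
    Real.smoothTransition.one_of_one_le ((one_le_div hε).2 hx)
  refine contDiffOn_two_of_transport hℓ hT (F := F)
    (Λ := fun z => χ z.2.1 * Λ z - (1 - χ z.2.1)) hW
    ((hχc.contDiffOn.mul hΛ).sub (contDiffOn_const.sub hχc.contDiffOn)) hF
    (fun t _ => by simp [hχ0]) (fun t ht => by simpa [hχ1 ℓ hεℓ] using h1 t ht) hini
    fun p hp => ?_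
  rcases le_or_gt ε p.1 with hpε | hpε
  · simpa [hχ1 _ hpε] using heq p hp
  · have hev : W =ᶠ[𝓝[Icc 0 ℓ ×ˢ Icc 0 T] p] fun _ => 0 := by
      filter_upwards [self_mem_nhdsWithin, mem_nhdsWithin_of_mem_nhds
        ((isOpen_lt continuous_fst continuous_const).mem_nhds hpε)] with q hq hqε
      exact hzero q hq (le_of_lt hqε)
    have hd : fderivWithin ℝ W (Icc 0 ℓ ×ˢ Icc 0 T) p = 0 := by
      rw [hev.fderivWithin_eq (hzero p hp hpε.le)]
      simp
    have := heq p hp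
    rw [hd] at this ⊢
    simpa using this

/-! ### The second time derivative at the initial time -/

/-- At `t = 0` both `W` and `∂ₜ W = F - Λ ∂ₓ W` vanish identically in `x`, hence so do `∂ₓ W` and, by
the symmetry of second derivatives, `∂ₜ ∂ₓ W`. What remains of the time derivative of the equation
is `∂ₜ F`. -/
lemma iteratedDerivWithin_two_time_eq_zero {ℓ T : ℝ} (hℓ : 0 < ℓ) (hT : 0 < T)
    {W : ℝ × ℝ → ℝ} {Λ F : ℝ × ℝ × ℝ → ℝ} (hW : ContDiffOn ℝ 2 W (Icc 0 ℓ ×ˢ Icc 0 T))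
    (hΛ : DifferentiableOn ℝ Λ (univ ×ˢ (Icc 0 ℓ ×ˢ Icc 0 T)))
    (hF : DifferentiableOn ℝ F (univ ×ˢ (Icc 0 ℓ ×ˢ Icc 0 T)))
    (hini : ∀ x ∈ Icc 0 ℓ, W (x, 0) = 0)
    (heq : ∀ p ∈ Icc 0 ℓ ×ˢ Icc 0 T, fderivWithin ℝ W (Icc 0 ℓ ×ˢ Icc 0 T) p (0, 1) +
      Λ (W p, p) * fderivWithin ℝ W (Icc 0 ℓ ×ˢ Icc 0 T) p (1, 0) = F (W p, p))
    (hF0 : ∀ x ∈ Icc 0 ℓ, F (0, x, 0) = 0)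
    (hFt : ∀ x ∈ Icc 0 ℓ, HasDerivWithinAt (fun t => F (0, x, t)) 0 (Icc 0 T) 0)
    {x : ℝ} (hx : x ∈ Icc 0 ℓ) :
    iteratedDerivWithin 2 (fun t => W (x, t)) (Icc 0 T) 0 = 0 := by
  set B : Set (ℝ × ℝ) := Icc 0 ℓ ×ˢ Icc 0 T with hB
  have hBu : UniqueDiffOn ℝ B := uniqueDiffOn_box hℓ hT
  have h0 : (0 : ℝ) ∈ Icc 0 T := left_mem_Icc.2 hT.le
  have hTu := uniqueDiffOn_Icc hT
  have hℓu := uniqueDiffOn_Icc hℓ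
  have hdW : ∀ p ∈ B, DifferentiableWithinAt ℝ W B p := hW.differentiableOn two_ne_zero
  have hmaps : MapsTo (fun p => (W p, p)) B (univ ×ˢ B) := fun p hp => ⟨mem_univ _, hp⟩
  have hD : ContDiffOn ℝ 1 (fderivWithin ℝ W B) B := hW.fderivWithin hBu (by norm_num)
  have hdD : ∀ p ∈ B, DifferentiableWithinAt ℝ (fderivWithin ℝ W B) B p :=
    hD.differentiableOn one_ne_zero
  have hdDv : ∀ v, ∀ p ∈ B, HasFDerivWithinAt (fun q => fderivWithin ℝ W B q v)
      ((fderivWithin ℝ (fderivWithin ℝ W B) B p).flip v) B p := fun v p hp => by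
    have := (hdD p hp).hasFDerivWithinAt.clm_apply (hasFDerivWithinAt_const v p B)
    simpa using this
  have hWx0 : ∀ y ∈ Icc 0 ℓ, fderivWithin ℝ W B (y, 0) (1, 0) = 0 := fun y hy =>
    (hℓu y hy).eq_deriv _
      (hasDerivWithinAt_fst_of_hasFDerivWithinAt h0 (hdW _ ⟨hy, h0⟩).hasFDerivWithinAt)
      ((hasDerivWithinAt_const y (Icc 0 ℓ) (0 : ℝ)).congr hini (hini y hy))
  have hWt0 : ∀ y ∈ Icc 0 ℓ, fderivWithin ℝ W B (y, 0) (0, 1) = 0 := fun y hy => by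
    have := heq (y, 0) ⟨hy, h0⟩
    rwa [hWx0 y hy, hini y hy, hF0 y hy, mul_zero, add_zero] at this
  have hp : (x, (0 : ℝ)) ∈ B := ⟨hx, h0⟩
  have hWtx0 : fderivWithin ℝ (fderivWithin ℝ W B) B (x, 0) (1, 0) (0, 1) = 0 :=
    (hℓu x hx).eq_deriv _
      (hasDerivWithinAt_fst_of_hasFDerivWithinAt h0 (hdDv (0, 1) _ hp))
      ((hasDerivWithinAt_const x (Icc 0 ℓ) (0 : ℝ)).congr hWt0 (hWt0 x hx))
  have hclos : (x, (0 : ℝ)) ∈ closure (interior B) := by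
    rw [hB, interior_prod_eq, closure_prod_eq, interior_Icc, interior_Icc, closure_Ioo hℓ.ne,
      closure_Ioo hT.ne]
    exact hp
  have hWxt0 : fderivWithin ℝ (fderivWithin ℝ W B) B (x, 0) (0, 1) (1, 0) = 0 := by
    exact ((hW _ hp).isSymmSndFDerivWithinAt (by simp) hBu hclos hp (0, 1) (1, 0)).trans hWtx0
  -- The time derivative of the source term along the graph of `W`.
  have hdF : DifferentiableWithinAt ℝ F (univ ×ˢ B) (W (x, 0), x, 0) := hF _ (hmaps hp)
  have hF' : fderivWithin ℝ F (univ ×ˢ B) (W (x, 0), x, 0) (0, 0, 1) = 0 := by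
    have h := hdF.hasFDerivWithinAt
    rw [hini x hx] at h ⊢
    exact (hTu 0 h0).eq_deriv _ (h.comp_hasDerivWithinAt (f := fun t => ((0 : ℝ), x, t)) 0
      ((hasDerivWithinAt_const _ _ _).prodMk
        ((hasDerivWithinAt_const _ _ _).prodMk (hasDerivWithinAt_id 0 _)))
      fun t ht => ⟨mem_univ _, hx, ht⟩) (hFt x hx)
  have hcompF : DifferentiableWithinAt ℝ (fun q => F (W q, q)) B (x, 0) :=
    hdF.comp (f := fun q => (W q, q)) _ ((hdW _ hp).prodMk differentiableWithinAt_id) hmaps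
  have hcompΛ : DifferentiableWithinAt ℝ (fun q => Λ (W q, q)) B (x, 0) :=
    (hΛ _ (hmaps hp)).comp (f := fun q => (W q, q)) _
      ((hdW _ hp).prodMk differentiableWithinAt_id) hmaps
  have d1 := hasDerivWithinAt_snd_of_hasFDerivWithinAt hx hcompF.hasFDerivWithinAt
  rw [fderivWithin_comp_graph hℓ hT hp (hdW _ hp) hdF, hF', hWt0 x hx, mul_zero, add_zero] at d1
  have d2 := hasDerivWithinAt_snd_of_hasFDerivWithinAt hx hcompΛ.hasFDerivWithinAt
  have d3 := hasDerivWithinAt_snd_of_hasFDerivWithinAt hx (hdDv (1, 0) _ hp)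
  rw [ContinuousLinearMap.flip_apply, hWxt0] at d3
  have d4 := d1.sub (d2.mul d3)
  rw [hWx0 x hx, mul_zero, mul_zero, add_zero, sub_zero] at d4
  have hWt : EqOn (derivWithin (fun t => W (x, t)) (Icc 0 T)) ((fun t => F (W (x, t), x, t)) -
      (fun t => Λ (W (x, t), x, t)) * fun t => fderivWithin ℝ W B (x, t) (1, 0)) (Icc 0 T) := by
    intro t ht
    rw [(hasDerivWithinAt_snd_of_hasFDerivWithinAt hx
      (hdW _ ⟨hx, ht⟩).hasFDerivWithinAt).derivWithin (hTu t ht)]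
    exact eq_sub_of_add_eq (heq (x, t) ⟨hx, ht⟩)
  rw [iteratedDerivWithin_succ, iteratedDerivWithin_one, derivWithin_congr hWt (hWt h0)]
  exact d4.derivWithin (hTu 0 h0)

/-! ### The averaged interaction function -/

lemma uniqueDiffOn_slab {ℓ T : ℝ} (hℓ : 0 < ℓ) (hT : 0 < T) :
    UniqueDiffOn ℝ ((univ : Set ℝ) ×ˢ (Icc 0 ℓ ×ˢ Icc 0 T)) :=
  uniqueDiffOn_univ.prod (uniqueDiffOn_box hℓ hT)

section phiHat

variable {ℓ T δ₁ : ℝ} {D : Set Plane} {φ : ℝ → ℝ → Plane → ℝ → ℝ}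

lemma contDiffOn_phiHat (hℓ : 0 < ℓ) (hT : 0 < T) (hD : IsCrossSection D)
    (hφ : InteractionAssumptions ℓ T δ₁ D φ) (n : ℕ) :
    ContDiffOn ℝ n (fun z : ℝ × ℝ × ℝ => phiHat D φ z.1 z.2.1 z.2.2)
      (univ ×ˢ (Icc 0 ℓ ×ˢ Icc 0 T)) := by
  refine contDiffOn_const.mul (contDiffOn_setIntegral
    (convex_univ.prod ((convex_Icc 0 ℓ).prod (convex_Icc 0 T))) (uniqueDiffOn_slab hℓ hT)
    hD.isCompact_frontier hD.hausdorffMeasure_frontier_lt_top n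
    (Φ := fun (z : ℝ × ℝ × ℝ) ξ => φ z.1 z.2.1 ξ z.2.2) ?_)
  exact (hφ.smooth.of_le (by exact_mod_cast le_top)).comp
    (f := fun y : (ℝ × ℝ × ℝ) × Plane => (y.1.1, y.1.2.1, y.2, y.1.2.2)) (by fun_prop)
    fun y hy => ⟨mem_univ _, hy.1.2.1, frontier_subset_closure hy.2, hy.1.2.2⟩

lemma phiHat_eq_zero {s x t : ℝ} (h : ∀ ξ ∈ closure D, φ s x ξ t = 0) : phiHat D φ s x t = 0 := by
  rw [phiHat, setIntegral_congr_fun isClosed_frontier.measurableSet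
    (fun ξ hξ => h ξ (frontier_subset_closure hξ))]
  simp

lemma hasDerivWithinAt_phiHat_zero (hT : 0 < T) (hD : IsCrossSection D)
    (hφ : InteractionAssumptions ℓ T δ₁ D φ) {s x : ℝ} (hx : x ∈ Icc 0 ℓ)
    (h : ∀ ξ ∈ closure D, derivWithin (fun t => φ s x ξ t) (Icc 0 T) 0 = 0) :
    HasDerivWithinAt (fun t => phiHat D φ s x t) 0 (Icc 0 T) 0 := by
  have hsm : ContDiffOn ℝ 1 (Function.uncurry fun (t : ℝ) ξ => φ s x ξ t)
      (Icc 0 T ×ˢ frontier D) :=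
    (hφ.smooth.of_le (by exact_mod_cast le_top)).comp
      (f := fun y : ℝ × Plane => (s, x, y.2, y.1)) (by fun_prop)
      fun y hy => ⟨mem_univ _, hx, frontier_subset_closure hy.2, hy.1⟩
  have hd := hasFDerivWithinAt_setIntegral_of_contDiffOn (convex_Icc 0 T) (uniqueDiffOn_Icc hT)
    hD.isCompact_frontier hD.hausdorffMeasure_frontier_lt_top le_rfl hsm (left_mem_Icc.2 hT.le)
  rw [setIntegral_congr_fun (g := fun _ => 0) isClosed_frontier.measurableSet (fun ξ hξ => by
    ext
    exact h ξ (frontier_subset_closure hξ)), integral_zero] at hd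
  have := hd.hasDerivWithinAt.const_mul (volume.real D)⁻¹
  simpa [phiHat] using this

end phiHat

/-! ### The quasilinear form of the limit problem -/

section Equation

variable {ℓ T : ℝ} {v₁ : ℝ → ℝ → ℝ → ℝ}

lemma deriv_eq_fderivWithin_slab {f : ℝ × ℝ × ℝ → ℝ} {s x t : ℝ} (hx : x ∈ Icc 0 ℓ)
    (ht : t ∈ Icc 0 T)
    (hf : DifferentiableWithinAt ℝ f (univ ×ˢ (Icc 0 ℓ ×ˢ Icc 0 T)) (s, x, t)) :
    deriv (fun σ => f (σ, x, t)) s =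
      fderivWithin ℝ f (univ ×ˢ (Icc 0 ℓ ×ˢ Icc 0 T)) (s, x, t) (1, 0) := by
  have := hf.hasFDerivWithinAt.comp_hasDerivWithinAt (f := fun σ => (σ, x, t)) (s := univ) s
    ((hasDerivWithinAt_id s _).prodMk (hasDerivWithinAt_const _ _ (x, t)))
    fun _ _ => ⟨mem_univ _, hx, ht⟩
  exact (hasDerivWithinAt_univ.1 this).deriv

/-- The characteristic speed `v₁ + s ∂ₛ v₁ = ∂ₛ (s v₁)`. -/
noncomputable def charSpeed (ℓ T : ℝ) (v₁ : ℝ → ℝ → ℝ → ℝ) (z : ℝ × ℝ × ℝ) : ℝ :=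
  v₁ z.1 z.2.1 z.2.2 + z.1 * fderivWithin ℝ (fun p : ℝ × ℝ × ℝ => v₁ p.1 p.2.1 p.2.2)
    (univ ×ˢ (Icc 0 ℓ ×ˢ Icc 0 T)) z (1, 0)

/-- The source term `-φ̂ - s ∂ₓ v₁` of the limit problem in quasilinear form. -/
noncomputable def sourceTerm (ℓ T : ℝ) (D : Set Plane) (v₁ : ℝ → ℝ → ℝ → ℝ)
    (φ : ℝ → ℝ → Plane → ℝ → ℝ) (z : ℝ × ℝ × ℝ) : ℝ :=
  -phiHat D φ z.1 z.2.1 z.2.2 - z.1 * fderivWithin ℝ (fun p : ℝ × ℝ × ℝ => v₁ p.1 p.2.1 p.2.2)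
    (univ ×ˢ (Icc 0 ℓ ×ˢ Icc 0 T)) z (0, 1, 0)

/-- A classical solution satisfies the quasilinear form of the equation up to the boundary, by
continuity. -/
lemma IsClassicalSolution.quasilinear {D : Set Plane} {φ : ℝ → ℝ → Plane → ℝ → ℝ} {w : ℝ → ℝ → ℝ}
    (hℓ : 0 < ℓ) (hT : 0 < T) (hw : IsClassicalSolution ℓ T D v₁ φ w)
    (hv : DifferentiableOn ℝ (fun p : ℝ × ℝ × ℝ => v₁ p.1 p.2.1 p.2.2)
      (univ ×ˢ (Icc 0 ℓ ×ˢ Icc 0 T)))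
    (hΛ : ContinuousOn (charSpeed ℓ T v₁) (univ ×ˢ (Icc 0 ℓ ×ˢ Icc 0 T)))
    (hF : ContinuousOn (sourceTerm ℓ T D v₁ φ) (univ ×ˢ (Icc 0 ℓ ×ˢ Icc 0 T))) :
    ∀ p ∈ Icc 0 ℓ ×ˢ Icc 0 T,
      fderivWithin ℝ (fun p : ℝ × ℝ => w p.1 p.2) (Icc 0 ℓ ×ˢ Icc 0 T) p (0, 1) +
        charSpeed ℓ T v₁ (w p.1 p.2, p) *
          fderivWithin ℝ (fun p : ℝ × ℝ => w p.1 p.2) (Icc 0 ℓ ×ˢ Icc 0 T) p (1, 0) =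
      sourceTerm ℓ T D v₁ φ (w p.1 p.2, p) := by
  have hW := hw.contDiffOn
  set W : ℝ × ℝ → ℝ := fun p => w p.1 p.2 with hWdef
  set B : Set (ℝ × ℝ) := Icc 0 ℓ ×ˢ Icc 0 T with hB
  have hBu : UniqueDiffOn ℝ B := uniqueDiffOn_box hℓ hT
  have hdW : ∀ p ∈ B, DifferentiableWithinAt ℝ W B p := hW.differentiableOn one_ne_zero
  have hgraph : ContinuousOn (fun p => (W p, p)) B := hW.continuousOn.prodMk continuousOn_id
  have hmaps : MapsTo (fun p => (W p, p)) B (univ ×ˢ B) := fun p hp => ⟨mem_univ _, hp⟩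
  have hWc : ∀ v, ContinuousOn (fun p => fderivWithin ℝ W B p v) B := fun v =>
    (hW.continuousOn_fderivWithin hBu le_rfl).clm_apply continuousOn_const
  have hsub : Ioo 0 ℓ ×ˢ Ioo 0 T ⊆ B := prod_mono Ioo_subset_Icc_self Ioo_subset_Icc_self
  refine EqOn.of_subset_closure (s := Ioo 0 ℓ ×ˢ Ioo 0 T) ?_
    ((hWc (0, 1)).add ((hΛ.comp hgraph hmaps).mul (hWc (1, 0)))) (hF.comp hgraph hmaps) hsub
    (by rw [closure_prod_eq, closure_Ioo hℓ.ne, closure_Ioo hT.ne])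
  rintro ⟨x, t⟩ ⟨hx, ht⟩
  have hp : (x, t) ∈ B := hsub ⟨hx, ht⟩
  have hnx : Icc 0 ℓ ∈ 𝓝 x := Icc_mem_nhds hx.1 hx.2
  have hnt : Icc 0 T ∈ 𝓝 t := Icc_mem_nhds ht.1 ht.2
  have hd := (hdW _ hp).hasFDerivWithinAt
  have ht' := (hasDerivWithinAt_snd_of_hasFDerivWithinAt hp.1 hd).hasDerivAt hnt
  have hx' := (hasDerivWithinAt_fst_of_hasFDerivWithinAt hp.2 hd).hasDerivAt hnx
  have hdv := hv _ (hmaps hp)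
  have hcomp := hdv.comp (f := fun q => (W q, q)) (x, t)
    ((hdW _ hp).prodMk differentiableWithinAt_id) hmaps
  have hv' := (hasDerivWithinAt_fst_of_hasFDerivWithinAt hp.2 hcomp.hasFDerivWithinAt).hasDerivAt
    hnx
  simp only [Function.comp_def] at hv'
  rw [fderivWithin_comp_graph hℓ hT hp (hdW _ hp) hdv] at hv'
  have he := hw.equation x hx t ht
  have e1 : deriv (fun τ => w x τ) t = fderivWithin ℝ W B (x, t) (0, 1) := ht'.deriv
  have e2 := (hv'.mul hx').deriv
  change deriv (fun y => v₁ (w y t) y t * w y t) x = _ at e2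
  rw [e1, e2] at he
  simp only [charSpeed, sourceTerm, hWdef] at he ⊢
  linear_combination he

end Equation

end ThinCylinder

theorem proposition2
    (ℓ T δ₁ : ℝ) (hℓ : 0 < ℓ) (hT : 0 < T) (hδ₁ : 0 < δ₁)
    (D : Set ThinCylinder.Plane) (hD : ThinCylinder.IsCrossSection D)
    (v₁ : ℝ → ℝ → ℝ → ℝ) (hv₁ : ThinCylinder.VelocityAssumptions ℓ T δ₁ v₁)
    (φ : ℝ → ℝ → ThinCylinder.Plane → ℝ → ℝ)
    (hφ : ThinCylinder.InteractionAssumptions ℓ T δ₁ D φ)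
    (hφ_zero : ∀ s : ℝ, ∀ x ∈ Icc 0 ℓ, ∀ ξ ∈ closure D, φ s x ξ 0 = 0)
    (hΛ : ∀ s : ℝ, ∀ t ∈ Icc 0 T, 0 < v₁ s 0 t + s * deriv (fun σ => v₁ σ 0 t) s)
    (hsign_phi : ∀ s : ℝ, 0 ≤ s → ∀ x ∈ Icc 0 ℓ, ∀ t ∈ Icc 0 T,
      ThinCylinder.phiHat D φ s x t ≤ 0)
    (hsign_v : ∀ s : ℝ, 0 ≤ s → ∀ x ∈ Icc 0 ℓ, ∀ t ∈ Icc 0 T,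
      derivWithin (fun y => v₁ s y t) (Icc 0 ℓ) x ≤ 0)
    (hφ_t : ∀ s : ℝ, ∀ x ∈ Icc 0 ℓ, ∀ ξ ∈ closure D,
      derivWithin (fun t => φ s x ξ t) (Icc 0 T) 0 = 0)
    (hφ_tt : ∀ s : ℝ, ∀ x ∈ Icc 0 ℓ, ∀ ξ ∈ closure D,
      iteratedDerivWithin 2 (fun t => φ s x ξ t) (Icc 0 T) 0 = 0)
    (T₁ : ℝ) (hT₁ : 0 < T₁) (hT₁T : T₁ ≤ T)
    (w₀ : ℝ → ℝ → ℝ) (hw₀ : ThinCylinder.IsClassicalSolution ℓ T₁ D v₁ φ w₀) :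
    ContDiffOn ℝ 2 (fun p : ℝ × ℝ => w₀ p.1 p.2) (Icc 0 ℓ ×ˢ Icc 0 T₁) ∧
    (∀ x ∈ Icc 0 ℓ, iteratedDerivWithin 2 (fun y => w₀ y 0) (Icc 0 ℓ) x = 0) ∧
    (∀ x ∈ Icc 0 ℓ, iteratedDerivWithin 2 (fun t => w₀ x t) (Icc 0 T₁) 0 = 0) := by
  open ThinCylinder in
  have hsub : (univ : Set ℝ) ×ˢ (Icc 0 ℓ ×ˢ Icc 0 T₁) ⊆ univ ×ˢ (Icc 0 ℓ ×ˢ Icc 0 T) :=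
    prod_mono_right (prod_mono_right (Icc_subset_Icc_right hT₁T))
  have hSu := uniqueDiffOn_slab hℓ hT₁
  have hT₁sub : Icc 0 T₁ ⊆ Icc 0 T := Icc_subset_Icc_right hT₁T
  have hv : ContDiffOn ℝ ∞ (fun p : ℝ × ℝ × ℝ => v₁ p.1 p.2.1 p.2.2)
      (univ ×ˢ (Icc 0 ℓ ×ˢ Icc 0 T₁)) := hv₁.smooth.mono hsub
  have hvd := hv.differentiableOn (by simp)
  have hv' : ∀ v, ContDiffOn ℝ 2 (fun z => fderivWithin ℝ (fun p : ℝ × ℝ × ℝ => v₁ p.1 p.2.1 p.2.2)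
      (univ ×ˢ (Icc 0 ℓ ×ˢ Icc 0 T₁)) z v) (univ ×ˢ (Icc 0 ℓ ×ˢ Icc 0 T₁)) := fun v =>
    (hv.fderivWithin hSu (WithTop.coe_le_coe.2 (le_top : (3 : ℕ∞) ≤ ⊤))).clm_apply contDiffOn_const
  have hΛc : ContDiffOn ℝ 2 (charSpeed ℓ T₁ v₁) (univ ×ˢ (Icc 0 ℓ ×ˢ Icc 0 T₁)) :=
    (hv.of_le (WithTop.coe_le_coe.2 (le_top : (2 : ℕ∞) ≤ ⊤))).add (contDiffOn_fst.mul (hv' (1, 0)))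
  have hFc : ContDiffOn ℝ 2 (sourceTerm ℓ T₁ D v₁ φ) (univ ×ˢ (Icc 0 ℓ ×ˢ Icc 0 T₁)) :=
    ((contDiffOn_phiHat hℓ hT hD hφ 2).mono hsub).neg.sub (contDiffOn_fst.mul (hv' (0, 1, 0)))
  have heq := hw₀.quasilinear hℓ hT₁ hvd hΛc.continuousOn hFc.continuousOn
  have hspeed : ∀ s, ∀ x ∈ Icc 0 ℓ, ∀ t ∈ Icc 0 T₁, charSpeed ℓ T₁ v₁ (s, x, t) =
      v₁ s x t + s * deriv (fun σ => v₁ σ x t) s := fun s x hx t ht => by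
    rw [charSpeed, ← deriv_eq_fderivWithin_slab hx ht (hvd _ ⟨mem_univ _, hx, ht⟩)]
  have hW : ContDiffOn ℝ 2 (fun p : ℝ × ℝ => w₀ p.1 p.2) (Icc 0 ℓ ×ˢ Icc 0 T₁) := by
    refine contDiffOn_two_of_inflow hℓ hT₁ hδ₁ hw₀.contDiffOn hΛc hFc
      (m := fun z => -fderivWithin ℝ (fun p : ℝ × ℝ × ℝ => v₁ p.1 p.2.1 p.2.2)
        (univ ×ˢ (Icc 0 ℓ ×ˢ Icc 0 T₁)) z (0, 1, 0)) (hv' (0, 1, 0)).neg.continuousOn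
      (fun s x hx hxδ t ht => ?_) (fun t ht => ?_) (fun t ht => ?_) hw₀.initial hw₀.boundary heq
    · have := phiHat_eq_zero (s := s) fun ξ hξ => hφ.vanish_left s x hx hxδ ξ hξ t (hT₁sub ht)
      simp only [sourceTerm, this]
      ring
    · rw [hspeed _ _ (left_mem_Icc.2 hℓ.le) t ht]
      exact hΛ _ t (hT₁sub ht)
    · obtain ⟨ς, hς, V, hV⟩ := hv₁.right_end
      obtain ⟨hVt, hVeq⟩ := hV t (hT₁sub ht)
      have hVℓ : ∀ s, v₁ s ℓ t = V t := fun s =>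
        hVeq s ℓ (right_mem_Icc.2 hℓ.le) (by linarith)
      rw [hspeed _ _ (right_mem_Icc.2 hℓ.le) t ht]
      simp only [hVℓ, deriv_const, mul_zero, add_zero]
      linarith
  refine ⟨hW, fun x hx => ?_, fun x hx => ?_⟩
  · rw [iteratedDerivWithin_congr (g := fun _ => 0) hw₀.initial hx,
      iteratedDerivWithin_fun_const_zero]
  · refine iteratedDerivWithin_two_time_eq_zero (W := fun p : ℝ × ℝ => w₀ p.1 p.2) hℓ hT₁ hW
      (hΛc.differentiableOn two_ne_zero) (hFc.differentiableOn two_ne_zero) hw₀.initial heq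
      (fun y hy => ?_) (fun y hy => ?_) hx
    · have := phiHat_eq_zero (s := 0) fun ξ hξ => hφ_zero 0 y hy ξ hξ
      simp [sourceTerm, this]
    · have := (hasDerivWithinAt_phiHat_zero hT hD hφ hy (hφ_t 0 y hy)).mono hT₁sub
      have h' := this.neg
      rw [neg_zero] at h'
      exact h'.congr (fun t _ => by simp [sourceTerm]) (by simp [sourceTerm])
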